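/- **Setting.** Let $(W,S)$ be a Coxeter system with length function $\ell$. For $I\subset S$ let $W_I$ be the subgroup generated by $I$; $I$ is *finitary* if $W_I$ is finite, and then $w_I$ denotes the longest element of $W_I$. Write $Is=I\cup\{s\}$. For finitary $I,J\subset S$, an *$(I,J)$-coset* is a double coset $p\in W_I\backslash W/W_J$; $\overline p$ and $\underline p$ denote its maximal and minimal elements in the Bruhat order. It is a *core* coset if $I\cap\underline pJ\underline p^{-1}=I$ and $\underline p^{-1}I\underline p\cap J=J$, and an *identity coset* if $I=J$ and $\underline p=1$. Let $*$ also denote the product of the Coxeter (0-Hecke) monoid on $W$: $s*w=w$ if $\ell(sw)<\ell(w)$ and $s*w=sw$ otherwise, for $s \in S$. For an $(I,J)$-coset $p$ and a $(J,K)$-coset $q$ put $p*q=W_I(\overline p*\overline q)W_K$. This composition is *reduced*, written $p.q$, if $\overline p*\overline q=(\overline pw_J^{-1})\overline q=\overline p(w_J^{-1}\overline q)$ and lengths add in both of these products. An *$(I,J)$-expression* is a sequence $[I=I_0,I_1,\dots,I_d=J]$ of finitary subsets in which each $I_i$ arises from $I_{i-1}$ by adding or removing one simple reflection. Write it as $[[I=L_0\subset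 K_1\supset L_1\subset\cdots\subset K_m\supset L_m=J]]$, by grouping consecutive additions and removals. It is a *reduced expression* for the $(I,J)$-coset $p$ if $\overline p=w_{K_1}w_{L_1}^{-1}w_{K_2}\cdots w_{L_{m-1}}^{-1}w_{K_m}$ and $\ell(\overline p)=\ell(w_{K_1})-\ell(w_{L_1})+\cdots-\ell(w_{L_{m-1}})+\ell(w_{K_m})$ (for $[I]$, take $m=1$ and $K_1=I$). Write $[I+s_1-s_2+\cdots-s_{2k}]$ for the expression with $I_{2i-1}=I_{2i-2}\cup\{s_{2i-1}\}$, $s_{2i-1}\notin I_{2i-2}$, and $I_{2i}=I_{2i-1}\setminus\{s_{2i}\}$, $s_{2i}\in I_{2i-1}$. An $(I,J)$-coset is *atomic* if it is core and has a reduced expression of the form $[I+s-t]$. **Theorem.** Let $r$ be a core $(I,J)$-coset. 1. There are $k\ge 0$ and $s_1,\dots,s_{2k}\in S$ such that $[I+s_1-s_2+\cdots+s_{2k-1}-s_{2k}]=[I=I_0,I_1,\dots,I_{2k}=J]$ is a reduced expression for $r$, $s_{2i}=w_{I_{2i-1}}s_{2i-1}w_{I_{2i-1}}$ for $1\le i\le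 k$, and $r=p_1.p_2.\cdots.p_k$ is a reduced composition of atomic cosets $p_i$, where $p_i$ has the reduced expression $[I_{2i-2},I_{2i-1},I_{2i}]$ (if $k=0$, $r$ is an identity coset). 2. Either $r$ is an identity coset, and then $[I]$ is its unique reduced expression; or $r=p.q$, where $q$ is a core coset and $p$ is an atomic coset with unique reduced expression $[I+s-t]$ for some $s\in S\setminus I$ with $Is$ finitary and $t=w_{Is}sw_{Is}$. 3. The following algorithm is correct. Given $r$, if the left descent set $D$ of $\overline r$ equals $I$, halt. Otherwise choose any $s\in D\setminus I$, put $t=w_{Is}sw_{Is}$ and $I'=Is\setminus\{t\}$, record $(s,t)$, and repeat with the $(I',J)$-coset $q$ containing $w_{I'}w_{Is}\overline r$ in place of $r$. More precisely: $D=I$ if and only if $r$ is an identity coset; if $D\neq I$, then $D\setminus I\ne\emptyset$, and for every $s\in D\setminus I$ the set $Is$ is finitary, $t\in S$, the $(I,I')$-coset $p$ containing $w_{Is}$ is atomic with reduced expression $[I+s-t]$, $q$ is core, $r=p.q$, and $\ell(\overline q)<\ell(\overline r)$. Hence the algorithm always halts, and the output $(s_1,s_2),(s_3,s_4),\dots,(s_{2k-1},s_{2k})$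 of every run gives an expression for $r$ as in part 1. -/

import Mathlib

namespace CoxeterSystem

variable {B W : Type*} [Group W] {M : CoxeterMatrix B} (cs : CoxeterSystem M W)

/-- The standard parabolic subgroup `W_I`. -/
def parabolic (I : Set B) : Subgroup W := Subgroup.closure (cs.simple '' I)

/-- `I` is finitary if `W_I` is finite. -/
def IsFinitary (I : Set B) : Prop := (cs.parabolic I : Set W).Finite

/-- The longest element `w_I` of `W_I` (meaningful for finitary `I`). -/
noncomputable def longest (I : Set B) : W :=
  Classical.epsilon fun w => w ∈ cs.parabolic I ∧ ∀ v ∈ cs.parabolic I, cs.length v ≤ cs.length w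

/-- The Bruhat order on `W`: the reflexive transitive closure of `u < u t`, where `t` is a reflection
with `ℓ(u) < ℓ(u t)`. -/
def BruhatLE : W → W → Prop :=
  Relation.ReflTransGen fun u v => ∃ t, cs.IsReflection t ∧ v = u * t ∧ cs.length u < cs.length v

/-- The Bruhat-maximal element of a double coset. -/
noncomputable def maxElt (p : Set W) : W :=
  Classical.epsilon fun x => x ∈ p ∧ ∀ y ∈ p, cs.BruhatLE y x

/-- The Bruhat-minimal element of a double coset. -/
noncomputable def minElt (p : Set W) : W :=
  Classical.epsilon fun x => x ∈ p ∧ ∀ y ∈ p, cs.BruhatLE x y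

/-- The left descent set of `w`. -/
def leftDescents (w : W) : Set B := {s | cs.IsLeftDescent w s}

/-! ### Double cosets and cores -/

/-- The double coset `W_I w W_J`. -/
def coset (I J : Set B) (w : W) : Set W :=
  DoubleCoset.doubleCoset w (cs.parabolic I : Set W) (cs.parabolic J : Set W)

/-- `p` is an `(I, J)`-coset, with `I` and `J` finitary. -/
def IsCoset (I J : Set B) (p : Set W) : Prop :=
  cs.IsFinitary I ∧ cs.IsFinitary J ∧ ∃ w, p = cs.coset I J w

/-- Left redundancy `I ∩ m J m⁻¹`, where `m` is the minimal element of `p`. -/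
def leftRed (I J : Set B) (p : Set W) : Set B :=
  {s | s ∈ I ∧ ∃ t ∈ J, cs.simple s = cs.minElt p * cs.simple t * (cs.minElt p)⁻¹}

/-- Right redundancy `m⁻¹ I m ∩ J`, where `m` is the minimal element of `p`. -/
def rightRed (I J : Set B) (p : Set W) : Set B :=
  {t | t ∈ J ∧ ∃ s ∈ I, cs.simple t = (cs.minElt p)⁻¹ * cs.simple s * cs.minElt p}

/-- `p` is a core `(I, J)`-coset. -/
def IsCore (I J : Set B) (p : Set W) : Prop :=
  cs.IsCoset I J p ∧ cs.leftRed I J p = I ∧ cs.rightRed I J p = J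

/-- The `(I, J)`-coset `p` is an identity coset. -/
def IsIdentity (I J : Set B) (p : Set W) : Prop :=
  cs.IsCoset I J p ∧ I = J ∧ cs.minElt p = 1

/-! ### Composition of cosets -/

open Classical in
/-- The product `s * w` in the Coxeter monoid: `w` if `s w < w`, and `s w` otherwise. -/
noncomputable def simpleStar (s : B) (w : W) : W :=
  if cs.IsLeftDescent w s then w else cs.simple s * w

/-- The product `x * y` in the Coxeter monoid (0-Hecke monoid): if `x = s₁ ⋯ sₙ` is reduced, then
`x * y = s₁ * (s₂ * ⋯ (sₙ * y))`. -/
noncomputable def star (x y : W) : W :=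
  (Classical.choose (cs.exists_isReduced x)).foldr cs.simpleStar y

/-- `x y = x.y`, that is, lengths add. -/
def IsReducedMul (x y : W) : Prop := cs.length (x * y) = cs.length x + cs.length y

/-- The composition `p * q` of an `(I, J)`-coset `p` and a `(J, K)`-coset `q`. -/
noncomputable def comp (I K : Set B) (p q : Set W) : Set W :=
  cs.coset I K (cs.star (cs.maxElt p) (cs.maxElt q))

/-- The composition of the `(I, J)`-coset `p` and the `(J, K)`-coset `q` is reduced. -/
def IsReducedComp (J : Set B) (p q : Set W) : Prop :=
  cs.IsReducedMul (cs.maxElt p * (cs.longest J)⁻¹) (cs.maxElt q) ∧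
  cs.maxElt p * (cs.longest J)⁻¹ * cs.maxElt q = cs.star (cs.maxElt p) (cs.maxElt q) ∧
  cs.IsReducedMul (cs.maxElt p) ((cs.longest J)⁻¹ * cs.maxElt q) ∧
  cs.maxElt p * ((cs.longest J)⁻¹ * cs.maxElt q) = cs.star (cs.maxElt p) (cs.maxElt q)

/-! ### Expressions -/

/-- `K` arises from `I` by adding or by removing exactly one simple reflection. -/
def SingleStep (I K : Set B) : Prop :=
  ∃ s, (s ∉ I ∧ K = insert s I) ∨ (s ∉ K ∧ I = insert s K)

/-- `L = [I = I₀, I₁, …, I_d = J]` is a (singlestep) `(I, J)`-expression. -/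
def IsExpression (I J : Set B) (L : List (Set B)) : Prop :=
  L.head? = some I ∧ L.getLast? = some J ∧ (∀ K ∈ L, cs.IsFinitary K) ∧ L.IsChain SingleStep

open Classical in
/-- For a sequence that decomposes as `[[I₀ ⊆ K₁ ⊇ I₁ ⊆ ⋯ ⊆ K_m ⊇ I_m]]`, this is
`w_{K₁} w_{I₁}⁻¹ w_{K₂} ⋯ w_{K_m} w_{I_m}⁻¹ w_{I_m}`; in a descending chain the inner factors
cancel, and an ascending step contributes nothing. -/
noncomputable def exprElt : List (Set B) → W
  | [] => 1
  | [I] => cs.longest I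
  | I :: K :: L =>
      (if I ⊆ K then 1 else cs.longest I * (cs.longest K)⁻¹) * exprElt (K :: L)

open Classical in
/-- The corresponding alternating sum of lengths
`ℓ(K₁) - ℓ(I₁) + ℓ(K₂) - ⋯ + ℓ(K_m) - ℓ(I_m) + ℓ(I_m)`. -/
noncomputable def exprLength : List (Set B) → ℤ
  | [] => 0
  | [I] => cs.length (cs.longest I)
  | I :: K :: L =>
      (if I ⊆ K then 0 else (cs.length (cs.longest I) : ℤ) - cs.length (cs.longest K)) +
        exprLength (K :: L)

/-- `L` is a reduced expression for the `(I, J)`-coset `p`. -/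
def IsReducedExpr (I J : Set B) (L : List (Set B)) (p : Set W) : Prop :=
  cs.IsCoset I J p ∧ cs.IsExpression I J L ∧ cs.maxElt p = cs.exprElt L ∧
    (cs.length (cs.maxElt p) : ℤ) = cs.exprLength L

/-- The sequence of sets `[I + s₁ - s₂ + s₃ - s₄ ⋯]` for the list `(s₁, s₂), (s₃, s₄), …`. -/
def plusMinus : Set B → List (B × B) → List (Set B)
  | I, [] => [I]
  | I, (s, t) :: l => I :: insert s I :: plusMinus (insert s I \ {t}) l

/-- An atomic coset: a core coset with a reduced expression `[I + s - t]`. -/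
def IsAtomic (I J : Set B) (p : Set W) : Prop :=
  cs.IsCore I J p ∧ ∃ s t, cs.IsReducedExpr I J (plusMinus I [(s, t)]) p

/-- `IsAtomicComposition J I p [(s₁, s₂), …, (s_{2k-1}, s_{2k})]` says that the `(I, J)`-coset `p` is
the reduced composition `p₁.p₂.⋯.p_k` of atomic cosets, where `p_i` has the reduced expression
`[I_{2i-2}, I_{2i-1}, I_{2i}] = [I_{2i-2} + s_{2i-1} - s_{2i}]` and
`s_{2i} = w_{I_{2i-1}} s_{2i-1} w_{I_{2i-1}}`. The empty composition is the identity coset. -/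
inductive IsAtomicComposition (J : Set B) : Set B → Set W → List (B × B) → Prop
  | nil : IsAtomicComposition J J (cs.coset J J 1) []
  | cons {I : Set B} {p q : Set W} {s t : B} {l : List (B × B)}
      (ht : cs.simple t = cs.longest (insert s I) * cs.simple s * cs.longest (insert s I))
      (hp : cs.IsAtomic I (insert s I \ {t}) p)
      (hexp : cs.IsReducedExpr I (insert s I \ {t}) [I, insert s I, insert s I \ {t}] p)
      (hpq : cs.IsReducedComp (insert s I \ {t}) p q)
      (hq : IsAtomicComposition J (insert s I \ {t}) q l) :
      IsAtomicComposition J I (cs.comp I J p q) ((s, t) :: l)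

/-- `[I + s₁ - s₂ + ⋯ - s_{2k}]` is a reduced atomic expression for the `(I, J)`-coset `p`. -/
def IsReducedAtomicExpr (I J : Set B) (l : List (B × B)) (p : Set W) : Prop :=
  cs.IsReducedExpr I J (plusMinus I l) p ∧ cs.IsAtomicComposition J I p l

/-! ### The algorithm -/

/-- One step of the algorithm, from the `(I, J)`-coset `p` to the `(I', J)`-coset `q`: choose
`s ∈ leftDescents (maxElt p) \ I`, put `t = w_{Is} s w_{Is}` and `I' = Is \ t`, and let `q` be the
`(I', J)`-coset containing `w_{I'} w_{Is} (maxElt p)`. -/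
def AlgStep (J I : Set B) (p : Set W) (s t : B) (I' : Set B) (q : Set W) : Prop :=
  s ∈ cs.leftDescents (cs.maxElt p) \ I ∧
  cs.simple t = cs.longest (insert s I) * cs.simple s * cs.longest (insert s I) ∧
  I' = insert s I \ {t} ∧
  q = cs.coset I' J (cs.longest I' * cs.longest (insert s I) * cs.maxElt p)

/-- `AlgRun J I p l`: some run of the algorithm on the `(I, J)`-coset `p` halts with output `l`. It
halts at an `(I', J)`-coset `q` with `leftDescents (maxElt q) = I'`. -/
inductive AlgRun (J : Set B) : Set B → Set W → List (B × B) → Prop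
  | halt {I : Set B} {p : Set W} (h : cs.leftDescents (cs.maxElt p) = I) : AlgRun J I p []
  | step {I I' : Set B} {p q : Set W} {s t : B} {l : List (B × B)}
      (h : cs.AlgStep J I p s t I' q) (hq : AlgRun J I' q l) : AlgRun J I p ((s, t) :: l)

end CoxeterSystem

/-! Let `m` be the minimal element of the core coset `r`. Being core means that conjugation by `m`
matches the simple reflections of `J` with those of `I`. Hence `r` is the one-sided coset `W_I m = m
W_J`, and its maximal element is `w_I m = m w_J` with lengths adding. The data of a core coset are
therefore just an element intertwining `I` with `J` and having no left descent in `I`; this is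
`IsCoreRep`.

Let `D` be the left descent set of `w_I m`, so `I ⊆ D`. If `m ≠ 1`, a left descent of `m` lies
outside `I` and, by the form `m w_J`, belongs to `D`; so `D = I` only for identity cosets. For `s ∈
D \ I` all of `Is` consists of left descents. Such a set is finitary and every element of its
parabolic subgroup is a prefix, so `w_I m = w_{Is} n` with lengths adding. Conjugation by `w_{Is}`
sends `s` to `t` and `I` onto `I' = Is \ t`, hence `n` intertwines `I'` with `J` and represents a
core coset `q` with maximum `w_{I'} n`. The coset `p` of `w_{Is}` is atomic, and `r = p.q` because
`w_{Is}` absorbs `W_{I'}` in the Coxeter monoid. The maximum loses length `ℓ(w_{Is}) - ℓ(w_{I'}) >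
0`, so the process ends and yields the atomic expression (`AlgStep.spec`,
`AlgRun.isReducedAtomicExpr`).

Uniqueness of the short expressions is a length count: the length sum of an expression is at least
`ℓ(w_X)` for its first set `X`, and the element of a reduced expression has its end sets among its
descents.

The underlying Coxeter theory rests on the geometric representation, which separates simple
reflections, and on the action on `W × ZMod 2`, which gives the exchange condition. -/

namespace CoxeterSystem

variable {B W : Type*} [Group W] {M : CoxeterMatrix B} (cs : CoxeterSystem M W)

/-! ### Simple reflections are pairwise distinct -/

section Geometric

open Real Module Polynomial.Chebyshev

/-- The linear form `2⟨α_i, ·⟩` of the geometric representation on `B →₀ ℝ`. -/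
noncomputable def geomForm (M : CoxeterMatrix B) (i : B) : Dual ℝ (B →₀ ℝ) :=
  Finsupp.linearCombination ℝ fun j => -2 * cos (π / M i j)

theorem geomForm_single (i j : B) :
    geomForm M i (Finsupp.single j 1) = -2 * cos (π / M i j) := by
  simp [geomForm]

theorem geomForm_single_self (i : B) : geomForm M i (Finsupp.single i 1) = 2 := by
  simp [geomForm]

/-- The reflection `σ_i` of the geometric representation. -/
noncomputable def geomReflection (M : CoxeterMatrix B) (i : B) : (B →₀ ℝ) ≃ₗ[ℝ] (B →₀ ℝ) :=
  reflection (geomForm_single_self (M := M) i)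

/-- The value `M i j = 0` encodes infinite order and imposes nothing; for `2` the two roots are
orthogonal. For `m ≥ 3` put `θ = 2π / m`: powers of the product of two reflections are given by
Chebyshev polynomials at `2 cos θ`, with values `sin ((n + 1) θ) / sin θ`, and the relevant ones
vanish or cancel because `m θ = 2π`. -/
theorem geomReflection_isLiftable : M.IsLiftable (geomReflection M) := by
  intro i j
  by_cases hij : i = j
  · subst hij
    ext1 z
    simp only [M.diagonal, pow_one]
    exact involutive_reflection (geomForm_single_self (M := M) i) z
  have h1 := M.off_diagonal i j hij
  rcases Nat.lt_or_ge (M i j) 3 with h3 | h3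
  · have h02 : M i j = 0 ∨ M i j = 2 := by omega
    rcases h02 with h | h
    · simp [h]
    · have hij0 : geomForm M i (Finsupp.single j 1) = 0 := by simp [geomForm_single, h]
      have hji0 : geomForm M j (Finsupp.single i 1) = 0 := by
        simp [geomForm_single, M.symmetric j i, h]
      apply LinearEquiv.ext
      intro z
      rw [h, pow_two]
      simp only [geomReflection, LinearEquiv.mul_apply, reflection_apply, map_sub, map_smul,
        geomForm_single_self, hij0, hji0]
      simp only [LinearEquiv.coe_one, id]
      module
  · set m := M i j with hm
    have hm0 : (m : ℝ) ≠ 0 := by positivity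
    set θ : ℝ := 2 * π / m with hθ
    have ht : 2 * cos θ =
        geomForm M i (Finsupp.single j 1) * geomForm M j (Finsupp.single i 1) - 2 := by
      rw [geomForm_single, geomForm_single, M.symmetric j i, ← hm,
        show θ = 2 * (π / m) by rw [hθ]; ring, cos_two_mul]
      ring
    -- This is where `m ≥ 3` enters: it gives `0 < θ < π`.
    have hsin : sin θ ≠ 0 := by
      apply ne_of_gt
      apply sin_pos_of_pos_of_lt_pi
      · positivity
      · rw [hθ, div_lt_iff₀ (by positivity)]
        have : (3 : ℝ) ≤ m := by exact_mod_cast h3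
        nlinarith [pi_pos]
    have hS (n : ℤ) : (S ℝ n).eval (2 * cos θ) = sin ((n + 1) * θ) / sin θ := by
      rw [eq_div_iff hsin, S_two_mul_real_cos]
    apply LinearEquiv.ext
    intro z
    rw [geomReflection, geomReflection, reflection_mul_reflection_pow_apply _ _ m z _ ht]
    rcases Nat.even_or_odd' m with ⟨k, hk | hk⟩
    · have e1 : ((m : ℤ) - 2) / 2 = k - 1 := by omega
      have e2 : ((m : ℤ) - 1) / 2 = k - 1 := by omega
      have h0 : (S ℝ ((k : ℤ) - 1)).eval (2 * cos θ) = 0 := by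
        rw [hS]
        have : (((k : ℤ) - 1 : ℤ) + 1 : ℝ) * θ = π := by
          have hk0 : (k : ℝ) ≠ 0 := by
            have : k ≠ 0 := by omega
            exact_mod_cast this
          rw [hθ, hk]; push_cast; field_simp; ring
        rw [this]; simp
      rw [e1, e2, h0]
      simp
    · have e1 : ((m : ℤ) - 2) / 2 = k - 1 := by omega
      have e2 : ((m : ℤ) - 1) / 2 = k := by omega
      have e3 : ((m : ℤ) - 3) / 2 = k - 1 := by omega
      have e4 : (m : ℤ) / 2 = k := by omega
      have h0 : (S ℝ (k : ℤ)).eval (2 * cos θ) + (S ℝ ((k : ℤ) - 1)).eval (2 * cos θ) = 0 := by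
        rw [hS, hS, ← add_div]
        have : (((k : ℤ) : ℝ) + 1) * θ = 2 * π - ((((k : ℤ) - 1 : ℤ) : ℝ) + 1) * θ := by
          have hk0 : (2 * k + 1 : ℝ) ≠ 0 := by positivity
          rw [hθ, hk]; push_cast; field_simp; ring
        rw [this, sin_two_pi_sub]; simp
      rw [e1, e2, e3, e4, h0]
      simp

/-- The `i`-th coordinate of the `i`-th basis vector changes sign under `σ_i`, but is fixed by `σ_j`
when `j ≠ i`. -/
theorem simple_injective : Function.Injective cs.simple := by
  intro i j h
  by_contra hij
  have h1 : geomReflection M i = geomReflection M j := by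
    rw [← cs.lift_apply_simple geomReflection_isLiftable i, h,
      cs.lift_apply_simple geomReflection_isLiftable j]
  have h2 := DFunLike.congr_fun (DFunLike.congr_fun h1 (Finsupp.single i 1)) i
  simp only [geomReflection, reflection_apply, geomForm_single_self] at h2
  simp [hij] at h2

end Geometric

/-! ### The exchange condition -/

section Exchange

open Classical in
/-- The permutation `(t, ε) ↦ (s t s, ε + [t = s])` of `W × ZMod 2`. -/
noncomputable def reflStep (i : B) : Function.End (W × ZMod 2) := fun x =>
  (cs.simple i * x.1 * cs.simple i, x.2 + if x.1 = cs.simple i then 1 else 0)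

open Classical in
theorem reflStep_prod_apply (ω : List B) (t : W) (ε : ZMod 2) :
    (ω.map cs.reflStep).prod (t, ε) =
      (cs.wordProd ω * t * (cs.wordProd ω)⁻¹, ε + ((cs.rightInvSeq ω).count t : ZMod 2)) := by
  induction ω with
  | nil => simp; rfl
  | cons i ω ih =>
    rw [List.map_cons, List.prod_cons]
    change cs.reflStep i ((ω.map cs.reflStep).prod (t, ε)) = _
    rw [ih, reflStep]
    refine Prod.ext ?_ ?_
    · simp [wordProd_cons, mul_assoc]
    · have : cs.wordProd ω * t * (cs.wordProd ω)⁻¹ = cs.simple i ↔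
          (cs.wordProd ω)⁻¹ * cs.simple i * cs.wordProd ω = t := by
        constructor
        · rintro h; rw [← h]; group
        · rintro h; rw [← h]; group
      simp only [rightInvSeq, List.count_cons, this, beq_iff_eq]
      push_cast
      ring

/-- Up to reversal this is a left inversion sequence whose entries are odd alternating products.
Since `(s_i s_j)^m = 1`, it has period `m`; its length is `2m`, so it is a list repeated twice. -/
theorem count_rightInvSeq_alternatingWord [DecidableEq W] (i j : B) (t : W) :
    Even ((cs.rightInvSeq (alternatingWord i j (2 * M i j))).count t) := by
  set p := M i j with hp
  have hrev : cs.rightInvSeq (alternatingWord i j (2 * p)) =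
      (cs.leftInvSeq (alternatingWord i j (2 * p)).reverse).reverse := by
    rw [leftInvSeq_reverse, List.reverse_reverse]
  have hr : (alternatingWord i j (2 * p)).reverse = alternatingWord j i (2 * p) := by
    apply List.ext_getElem (by simp)
    intro n h1 h2
    simp only [List.length_reverse, length_alternatingWord] at h1
    rw [List.getElem_reverse, getElem_alternatingWord _ _ _ _ (by simp; omega),
      getElem_alternatingWord _ _ _ _ h1]
    simp only [length_alternatingWord]
    by_cases hn : Even n
    · rw [if_neg, if_pos]
      · exact (Nat.even_add.2 (by simp [hn]))
      · rw [Nat.not_even_iff_odd]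
        obtain ⟨a, rfl⟩ := hn
        exact ⟨2 * p - 1 - a, by omega⟩
    · rw [if_pos, if_neg]
      · rw [Nat.even_add]; simp [hn]
      · rw [Nat.not_even_iff_odd] at hn
        obtain ⟨a, rfl⟩ := hn
        exact ⟨2 * p - 1 - a, by omega⟩
  rw [hrev, hr, List.count_reverse]
  set L := cs.leftInvSeq (alternatingWord j i (2 * p)) with hL
  have hlen : L.length = 2 * p := by simp [hL]
  have hperiod : ∀ k, (h : k < p) → L[k]'(by omega) = L[p + k]'(by omega) := by
    intro k hk
    simp only [hL]
    rw [cs.getElem_leftInvSeq_alternatingWord j i p k (by omega),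
      cs.getElem_leftInvSeq_alternatingWord j i p (p + k) (by omega)]
    rw [prod_alternatingWord_eq_mul_pow, prod_alternatingWord_eq_mul_pow]
    have e1 : (2 * k + 1) / 2 = k := by omega
    have e2 : (2 * (p + k) + 1) / 2 = p + k := by omega
    rw [e1, e2, pow_add, hp, cs.simple_mul_simple_pow, one_mul]
    simp
  have hsplit : L.take p = L.drop p := by
    apply List.ext_getElem (by simp [hlen]; omega)
    intro n h1 h2
    simp only [List.length_take] at h1
    rw [List.getElem_take, List.getElem_drop]
    exact hperiod n (by omega)
  rw [← List.take_append_drop p L, List.count_append, hsplit]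
  exact ⟨_, rfl⟩

/-- A braid relator has product `1` and hits every reflection an even number of times, so it acts
trivially on both coordinates. -/
theorem reflStep_isLiftable : M.IsLiftable cs.reflStep := by
  classical
  intro i j
  have hpow : ∀ n, (cs.reflStep i * cs.reflStep j) ^ n =
      ((alternatingWord i j (2 * n)).map cs.reflStep).prod := by
    intro n
    induction n with
    | zero => simp [alternatingWord]
    | succ n ih =>
      rw [pow_succ', ih, show 2 * (n + 1) = 2 * n + 1 + 1 by ring, alternatingWord_succ',
        alternatingWord_succ', if_neg (by simp [parity_simps]), if_pos (by simp)]
      simp [mul_assoc]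
  rw [hpow]
  funext ⟨t, ε⟩
  have h1 : cs.wordProd (alternatingWord i j (2 * M i j)) = 1 := by
    rw [prod_alternatingWord_eq_mul_pow]; simp
  rw [reflStep_prod_apply, h1]
  have := cs.count_rightInvSeq_alternatingWord i j t
  rw [← ZMod.natCast_eq_zero_iff_even] at this
  rw [this]
  simp; rfl

/-- The parity of the number of occurrences of `t` in the right inversion sequence of a word depends
only on the product of the word. -/
theorem count_rightInvSeq_congr [DecidableEq W] {ω ω' : List B}
    (h : cs.wordProd ω = cs.wordProd ω') (t : W) :
    ((cs.rightInvSeq ω).count t : ZMod 2) = ((cs.rightInvSeq ω').count t : ZMod 2) := by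
  classical
  have key : ∀ ω : List B, cs.lift ⟨_, cs.reflStep_isLiftable⟩ (cs.wordProd ω) =
      (ω.map cs.reflStep).prod := by
    intro ω
    rw [wordProd, map_list_prod, List.map_map]
    congr 1
    apply List.map_congr_left
    intro a _
    exact cs.lift_apply_simple cs.reflStep_isLiftable a
  have h1 := congrFun ((key ω).symm.trans ((congrArg _ h).trans (key ω'))) (t, 0)
  rw [reflStep_prod_apply, reflStep_prod_apply] at h1
  have h2 := congrArg Prod.snd h1
  simp only [zero_add] at h2
  convert h2

/-- A right descent of the product of a word occurs in its right inversion sequence. -/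
theorem simple_mem_rightInvSeq {ω : List B} {i : B}
    (h : cs.IsRightDescent (cs.wordProd ω) i) : cs.simple i ∈ cs.rightInvSeq ω := by
  classical
  by_contra hmem
  obtain ⟨η, hη, hη'⟩ := cs.exists_isReduced (cs.wordProd ω * cs.simple i)
  -- Appending `i` adds one entry `s_i` and conjugates the others by `s_i`, which creates no further
  -- `s_i`. The odd count passes to the reduced word `η`, making `s_i` a right inversion of `w s_i`,
  -- contrary to `ℓ(w s_i) < ℓ(w)`.
  have hc : (((cs.rightInvSeq (ω.concat i)).count (cs.simple i) : ℕ) : ZMod 2) = 1 := by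
    rw [rightInvSeq_concat, List.concat_eq_append, List.count_append]
    have : (List.map (MulAut.conj (cs.simple i)) (cs.rightInvSeq ω)).count (cs.simple i) = 0 := by
      rw [List.count_eq_zero]
      intro hx
      obtain ⟨y, hy, hy'⟩ := List.mem_map.1 hx
      apply hmem
      rw [MulAut.conj_apply] at hy'
      have : y = cs.simple i := by
        have := congrArg (fun z => (cs.simple i)⁻¹ * z * cs.simple i) hy'
        simpa [mul_assoc] using this
      rwa [← this]
    rw [this]; simp
  rw [cs.count_rightInvSeq_congr (ω' := η) (by rw [wordProd_concat, hη'])] at hc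
  have hin : cs.simple i ∈ cs.rightInvSeq η := by
    by_contra hn
    rw [List.count_eq_zero.2 hn] at hc
    simp at hc
  have := (cs.isRightInversion_of_mem_rightInvSeq hη hin).2
  rw [← hη', simple_mul_simple_cancel_right] at this
  unfold IsRightDescent at h
  omega

/-- A left descent of the product of a word occurs in its left inversion sequence. -/
theorem simple_mem_leftInvSeq {ω : List B} {i : B}
    (h : cs.IsLeftDescent (cs.wordProd ω) i) : cs.simple i ∈ cs.leftInvSeq ω := by
  rw [← isRightDescent_inv_iff, ← wordProd_reverse] at h
  simpa [rightInvSeq_reverse] using cs.simple_mem_rightInvSeq h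

/-- The exchange condition. -/
theorem exchange_left {ω : List B} {i : B} (h : cs.IsLeftDescent (cs.wordProd ω) i) :
    ∃ j < ω.length, cs.simple i * cs.wordProd ω = cs.wordProd (ω.eraseIdx j) := by
  obtain ⟨j, hj, hj'⟩ := List.mem_iff_getElem.1 (cs.simple_mem_leftInvSeq h)
  refine ⟨j, by simpa using hj, ?_⟩
  rw [← getD_leftInvSeq_mul_wordProd, List.getD_eq_getElem _ _ hj, hj']

end Exchange

/-! ### Parabolic subgroups -/

theorem simple_mem_parabolic {I : Set B} {i : B} (hi : i ∈ I) : cs.simple i ∈ cs.parabolic I :=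
  Subgroup.subset_closure ⟨i, hi, rfl⟩

theorem wordProd_mem_parabolic {I : Set B} {ω : List B} (h : ∀ i ∈ ω, i ∈ I) :
    cs.wordProd ω ∈ cs.parabolic I := by
  induction ω with
  | nil => simp
  | cons i ω ih =>
    rw [wordProd_cons]
    exact mul_mem (cs.simple_mem_parabolic (h i (by simp))) (ih fun j hj => h j (by simp [hj]))

theorem mem_parabolic_univ (w : W) : w ∈ cs.parabolic Set.univ := by
  obtain ⟨ω, -, rfl⟩ := cs.exists_isReduced w
  exact cs.wordProd_mem_parabolic (by simp)

theorem parabolic_mono {I K : Set B} (h : I ⊆ K) : cs.parabolic I ≤ cs.parabolic K :=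
  Subgroup.closure_mono (Set.image_mono h)

theorem IsFinitary.mono {cs : CoxeterSystem M W} {I K : Set B} (hK : cs.IsFinitary K)
    (h : I ⊆ K) : cs.IsFinitary I :=
  Set.Finite.subset hK (cs.parabolic_mono h)

theorem isReduced_of_length_le {ω : List B} (h : ω.length ≤ cs.length (cs.wordProd ω)) :
    cs.IsReduced ω :=
  le_antisymm (cs.length_wordProd_le ω) h

/-- Elements of `W_I` have reduced words with letters in `I`. -/
theorem exists_isReduced_of_mem_parabolic {I : Set B} {a : W} (ha : a ∈ cs.parabolic I) :
    ∃ ω : List B, cs.IsReduced ω ∧ (∀ i ∈ ω, i ∈ I) ∧ a = cs.wordProd ω := by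
  -- When the length drops, exchange deletes a letter of the given word, so no letter outside `I`
  -- appears.
  have step : ∀ i ∈ I, ∀ a : W, (∃ ω : List B, cs.IsReduced ω ∧ (∀ i ∈ ω, i ∈ I) ∧
      a = cs.wordProd ω) → ∃ ω : List B, cs.IsReduced ω ∧ (∀ i ∈ ω, i ∈ I) ∧
      cs.simple i * a = cs.wordProd ω := by
    rintro i hi _ ⟨ω, hω, hI, rfl⟩
    by_cases hd : cs.IsLeftDescent (cs.wordProd ω) i
    · obtain ⟨j, hj, he⟩ := cs.exchange_left hd
      refine ⟨ω.eraseIdx j, ?_, fun k hk => hI k (List.mem_of_mem_eraseIdx hk), he⟩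
      apply cs.isReduced_of_length_le
      rw [← he]
      have h1 := (cs.isLeftDescent_iff).1 hd
      have h2 := List.length_eraseIdx_add_one hj
      have h3 := hω.eq
      omega
    · refine ⟨i :: ω, ?_, by simpa [hi] using hI, (cs.wordProd_cons i ω).symm⟩
      apply cs.isReduced_of_length_le
      rw [wordProd_cons, (cs.not_isLeftDescent_iff).1 hd, hω.eq]
      simp
  induction ha using Subgroup.closure_induction_left with
  | one => exact ⟨[], by simp [IsReduced], by simp, by simp⟩
  | mul_left x hx y _ ih =>
    obtain ⟨i, hi, rfl⟩ := hx
    exact step i hi y ih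
  | inv_mul_cancel x hx y _ ih =>
    obtain ⟨i, hi, rfl⟩ := hx
    rw [inv_simple]
    exact step i hi y ih

/-- Induction along reduced words in a parabolic subgroup. -/
theorem parabolic_induction {I : Set B} {P : W → Prop} (one : P 1)
    (mul : ∀ i ∈ I, ∀ a ∈ cs.parabolic I, cs.length (cs.simple i * a) = cs.length a + 1 →
      P a → P (cs.simple i * a)) {a : W} (ha : a ∈ cs.parabolic I) : P a := by
  obtain ⟨ω, hω, hI, rfl⟩ := cs.exists_isReduced_of_mem_parabolic ha
  clear ha
  induction ω with
  | nil => simpa using one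
  | cons i ω ih =>
    have hr : cs.IsReduced ω := hω.drop 1
    have hI' : ∀ k ∈ ω, k ∈ I := fun k hk => hI k (by simp [hk])
    have hl := hω.eq
    rw [wordProd_cons] at hl ⊢
    refine mul i (hI i (by simp)) _ (cs.wordProd_mem_parabolic hI') ?_ (ih hr hI')
    rw [hl, hr.eq]; simp

theorem simple_mem_parabolic_iff {I : Set B} {i : B} :
    cs.simple i ∈ cs.parabolic I ↔ i ∈ I := by
  refine ⟨fun h => ?_, cs.simple_mem_parabolic⟩
  obtain ⟨ω, hω, hI, he⟩ := cs.exists_isReduced_of_mem_parabolic h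
  have hl := hω.eq
  rw [← he, length_simple] at hl
  obtain ⟨j, rfl⟩ := List.length_eq_one_iff.1 hl.symm
  rw [wordProd_singleton] at he
  rw [cs.simple_injective he]
  exact hI j (by simp)

/-- The exchange condition for a left descent of a product. -/
theorem exchange_left_mul {I K : Set B} {a c : W} {i : B} (ha : a ∈ cs.parabolic I)
    (hc : c ∈ cs.parabolic K) (h : cs.IsLeftDescent (a * c) i) :
    (cs.simple i * a ∈ cs.parabolic I ∧ cs.length (cs.simple i * a) < cs.length a) ∨
      ∃ c' ∈ cs.parabolic K, cs.length c' < cs.length c ∧ cs.simple i * (a * c) = a * c' := by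
  obtain ⟨ω, hω, hI, rfl⟩ := cs.exists_isReduced_of_mem_parabolic ha
  obtain ⟨η, hη, hK, rfl⟩ := cs.exists_isReduced_of_mem_parabolic hc
  rw [← wordProd_append] at h
  obtain ⟨j, hj, he⟩ := cs.exchange_left h
  rw [List.length_append] at hj
  rcases Nat.lt_or_ge j ω.length with hlt | hge
  · left
    rw [List.eraseIdx_append_of_lt_length hlt, wordProd_append, wordProd_append, ← mul_assoc,
      mul_left_inj] at he
    rw [he, hω.eq]
    refine ⟨cs.wordProd_mem_parabolic fun k hk => hI k (List.mem_of_mem_eraseIdx hk), ?_⟩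
    have h2 := List.length_eraseIdx_add_one hlt
    have h3 := cs.length_wordProd_le (ω.eraseIdx j)
    omega
  · right
    rw [List.eraseIdx_append_of_length_le hge, wordProd_append, wordProd_append] at he
    refine ⟨_, cs.wordProd_mem_parabolic fun k hk => hK k (List.mem_of_mem_eraseIdx hk), ?_, he⟩
    have h2 := List.length_eraseIdx_add_one (l := η) (i := j - ω.length) (by omega)
    have h3 := cs.length_wordProd_le (η.eraseIdx (j - ω.length))
    have h4 := hη.eq
    omega

/-- The exchange condition for a right descent of a product. -/
theorem exchange_right_mul {I K : Set B} {a c : W} {i : B} (ha : a ∈ cs.parabolic I)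
    (hc : c ∈ cs.parabolic K) (h : cs.IsRightDescent (a * c) i) :
    (c * cs.simple i ∈ cs.parabolic K ∧ cs.length (c * cs.simple i) < cs.length c) ∨
      ∃ a' ∈ cs.parabolic I, cs.length a' < cs.length a ∧ a * c * cs.simple i = a' * c := by
  rw [← isLeftDescent_inv_iff, mul_inv_rev] at h
  rcases cs.exchange_left_mul (inv_mem hc) (inv_mem ha) h with ⟨h1, h2⟩ | ⟨x, hx, h1, h2⟩
  · left
    have h3 := inv_mem h1
    rw [← cs.length_inv, ← cs.length_inv c⁻¹] at h2
    simp only [mul_inv_rev, inv_inv, inv_simple] at h2 h3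
    exact ⟨h3, h2⟩
  · right
    refine ⟨x⁻¹, inv_mem hx, by simpa using h1, ?_⟩
    have h3 := congrArg (·⁻¹) h2
    simpa [mul_assoc] using h3

/-- In the exchange condition for `a * 1` nothing can be deleted from the second factor, so `s_i a`
stays in `W_I`. -/
theorem mem_of_isLeftDescent {I : Set B} {a : W} {i : B} (ha : a ∈ cs.parabolic I)
    (h : cs.IsLeftDescent a i) : i ∈ I := by
  have h' : cs.IsLeftDescent (a * 1) i := by rwa [mul_one]
  rcases cs.exchange_left_mul ha (one_mem (cs.parabolic I)) h' with ⟨h1, -⟩ | ⟨c, -, h1, -⟩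
  · exact cs.simple_mem_parabolic_iff.1 ((Subgroup.mul_mem_cancel_right _ ha).1 h1)
  · simp at h1

/-- If `m` is minimal in `W_I m`, lengths add in `a m` for `a ∈ W_I`. -/
theorem length_mul_of_forall_le {I : Set B} {m : W}
    (hm : ∀ a ∈ cs.parabolic I, cs.length m ≤ cs.length (a * m)) {a : W}
    (ha : a ∈ cs.parabolic I) : cs.length (a * m) = cs.length a + cs.length m := by
  refine cs.parabolic_induction (P := fun a => cs.length (a * m) = cs.length a + cs.length m)
    (by simp) ?_ ha
  intro i hi a ha hl ih
  by_cases hd : cs.IsLeftDescent (a * m) i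
  · exfalso
    rcases cs.exchange_left_mul ha (cs.mem_parabolic_univ m) hd with ⟨-, h⟩ | ⟨c, -, h1, h2⟩
    · omega
    · have := hm (a⁻¹ * (cs.simple i * a))
        (mul_mem (inv_mem ha) (mul_mem (cs.simple_mem_parabolic hi) ha))
      rw [mul_assoc, mul_assoc, h2, inv_mul_cancel_left] at this
      omega
  · rw [mul_assoc, (cs.not_isLeftDescent_iff).1 hd, ih, hl]
    omega

/-- Local minimality implies global minimality. Let `b m` be shortest in `W_I m`, so that lengths
add over it; if `b ≠ 1`, a left descent of `b⁻¹` lies in `I` and is one of `m = b⁻¹ (b m)`. -/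
theorem length_mul_of_not_isLeftDescent {I : Set B} {m : W}
    (hm : ∀ i ∈ I, ¬ cs.IsLeftDescent m i) {a : W} (ha : a ∈ cs.parabolic I) :
    cs.length (a * m) = cs.length a + cs.length m := by
  obtain ⟨b, hb, hmin⟩ : ∃ b ∈ cs.parabolic I, ∀ c ∈ cs.parabolic I,
      cs.length (b * m) ≤ cs.length (c * m) := by
    have := Function.argminOn_mem (fun b => cs.length (b * m)) (cs.parabolic I : Set W)
      ⟨1, one_mem _⟩
    exact ⟨_, this, fun c hc =>
      Function.argminOn_le (fun b => cs.length (b * m)) _ hc⟩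
  have hadd : ∀ c ∈ cs.parabolic I,
      cs.length (c * (b * m)) = cs.length c + cs.length (b * m) := fun c hc =>
    cs.length_mul_of_forall_le (fun d hd => by rw [← mul_assoc]; exact hmin _ (mul_mem hd hb)) hc
  by_cases hb1 : b = 1
  · subst hb1
    simpa using hadd a ha
  · exfalso
    obtain ⟨i, hi⟩ := cs.exists_leftDescent_of_ne_one (inv_ne_one.2 hb1)
    have hiI := cs.mem_of_isLeftDescent (inv_mem hb) hi
    apply hm i hiI
    have h1 := hadd _ (mul_mem (cs.simple_mem_parabolic hiI) (inv_mem hb))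
    have h2 := hadd _ (inv_mem hb)
    rw [mul_assoc, inv_mul_cancel_left] at h1
    rw [inv_mul_cancel_left] at h2
    unfold IsLeftDescent at hi ⊢
    omega

theorem length_mul_of_not_isRightDescent {I : Set B} {m : W}
    (hm : ∀ i ∈ I, ¬ cs.IsRightDescent m i) {a : W} (ha : a ∈ cs.parabolic I) :
    cs.length (m * a) = cs.length m + cs.length a := by
  have := cs.length_mul_of_not_isLeftDescent (m := m⁻¹)
    (fun i hi => by rw [isLeftDescent_inv_iff]; exact hm i hi) (inv_mem ha)
  rw [← mul_inv_rev, length_inv, length_inv, length_inv] at this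
  omega

/-- If every element of `I` is a left descent of `y`, then every `a ∈ W_I` is a prefix of `y`. -/
theorem length_add_length_inv_mul {I : Set B} {y : W} (hy : I ⊆ cs.leftDescents y) {a : W}
    (ha : a ∈ cs.parabolic I) : cs.length a + cs.length (a⁻¹ * y) = cs.length y := by
  refine cs.parabolic_induction
    (P := fun a => cs.length a + cs.length (a⁻¹ * y) = cs.length y) (by simp) ?_ ha
  intro i hi a ha hl ih
  -- Since `s_i a` is longer than `a`, the exchanged letter lies in `a⁻¹ y`, and what remains of
  -- that factor is `(s_i a)⁻¹ y`.
  have hd : cs.IsLeftDescent (a * (a⁻¹ * y)) i := by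
    rw [mul_inv_cancel_left]; exact hy hi
  rcases cs.exchange_left_mul ha (cs.mem_parabolic_univ _) hd with ⟨-, h⟩ | ⟨c, -, h1, h2⟩
  · omega
  · rw [mul_inv_cancel_left] at h2
    have h3 : (cs.simple i * a)⁻¹ * y = c := by
      rw [mul_inv_rev, inv_simple, mul_assoc, h2, inv_mul_cancel_left]
    have h4 := cs.length_mul_le (cs.simple i * a) ((cs.simple i * a)⁻¹ * y)
    rw [mul_inv_cancel_left] at h4
    rw [h3] at h4 ⊢
    omega

/-- All left descents occur in the inversion sequence of one fixed word, even when `B` is infinite.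
-/
theorem leftDescents_finite (y : W) : (cs.leftDescents y).Finite := by
  obtain ⟨ω, -, rfl⟩ := cs.exists_isReduced y
  refine Set.Finite.of_finite_image (f := cs.simple) ?_ (cs.simple_injective.injOn)
  refine ((cs.leftInvSeq ω).finite_toSet).subset ?_
  rintro _ ⟨i, hi, rfl⟩
  exact cs.simple_mem_leftInvSeq hi

/-- A set of left descents is finitary. -/
theorem isFinitary_of_subset_leftDescents {I : Set B} {y : W} (hy : I ⊆ cs.leftDescents y) :
    cs.IsFinitary I := by
  have hI : I.Finite := (cs.leftDescents_finite y).subset hy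
  have : Finite I := hI
  -- Elements of `W_I` are prefixes of `y`, hence come from words of length at most `ℓ(y)` over the
  -- finite alphabet `I`.
  have hf := List.finite_length_le I (cs.length y)
  refine (hf.image fun l => cs.wordProd (l.map Subtype.val)).subset ?_
  intro a ha
  obtain ⟨ω, hω, hωI, rfl⟩ := cs.exists_isReduced_of_mem_parabolic ha
  refine ⟨ω.attach.map fun x => ⟨x.1, hωI x.1 x.2⟩, ?_, ?_⟩
  · have := cs.length_add_length_inv_mul hy ha
    have h2 := hω.eq
    simp
    omega
  · simp [List.map_map, Function.comp_def]

/-! ### Longest elements -/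

section Longest

variable {cs} {I : Set B}

theorem longest_spec (hI : cs.IsFinitary I) : cs.longest I ∈ cs.parabolic I ∧
    ∀ v ∈ cs.parabolic I, cs.length v ≤ cs.length (cs.longest I) := by
  apply Classical.epsilon_spec (p := fun w => w ∈ cs.parabolic I ∧
    ∀ v ∈ cs.parabolic I, cs.length v ≤ cs.length w)
  obtain ⟨w, hw, h⟩ := Set.exists_max_image (cs.parabolic I : Set W) cs.length hI ⟨1, one_mem _⟩
  exact ⟨w, hw, h⟩

theorem longest_mem (hI : cs.IsFinitary I) : cs.longest I ∈ cs.parabolic I := (longest_spec hI).1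

theorem leftDescents_longest (hI : cs.IsFinitary I) : cs.leftDescents (cs.longest I) = I := by
  ext i
  refine ⟨fun h => cs.mem_of_isLeftDescent (longest_mem hI) h, fun hi => ?_⟩
  have h1 := (longest_spec hI).2 _ (mul_mem (cs.simple_mem_parabolic hi) (longest_mem hI))
  exact lt_of_le_of_ne h1 (cs.length_simple_mul_ne _ _)

theorem length_mul_longest (hI : cs.IsFinitary I) {a : W} (ha : a ∈ cs.parabolic I) :
    cs.length a + cs.length (a * cs.longest I) = cs.length (cs.longest I) := by
  have := cs.length_add_length_inv_mul (leftDescents_longest hI).ge (inv_mem ha)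
  rwa [inv_inv, length_inv] at this

/-- An element of `W_I` with all left descents in `I` is the longest element. -/
theorem eq_longest (hI : cs.IsFinitary I) {a : W} (ha : a ∈ cs.parabolic I)
    (h : I ⊆ cs.leftDescents a) : a = cs.longest I := by
  have h1 := cs.length_add_length_inv_mul h (longest_mem hI)
  have h2 := (longest_spec hI).2 a ha
  have h3 : cs.length ((cs.longest I)⁻¹ * a) = 0 := by omega
  rw [length_eq_zero_iff, inv_mul_eq_one] at h3
  exact h3.symm

theorem longest_mul_self (hI : cs.IsFinitary I) : cs.longest I * cs.longest I = 1 := by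
  have h := length_mul_longest hI (longest_mem hI)
  rw [← cs.length_eq_zero_iff]
  omega

theorem longest_inv (hI : cs.IsFinitary I) : (cs.longest I)⁻¹ = cs.longest I :=
  inv_eq_of_mul_eq_one_left (longest_mul_self hI)

theorem longest_mul_longest_mul (hI : cs.IsFinitary I) (w : W) :
    cs.longest I * (cs.longest I * w) = w := by
  rw [← mul_assoc, longest_mul_self hI, one_mul]

theorem length_longest_mul (hI : cs.IsFinitary I) {a : W} (ha : a ∈ cs.parabolic I) :
    cs.length a + cs.length (cs.longest I * a) = cs.length (cs.longest I) := by
  have := length_mul_longest hI (inv_mem ha)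
  rwa [length_inv, ← cs.length_inv (_ * _), mul_inv_rev, inv_inv, longest_inv hI] at this

/-- Multiplication by `w_I` on either side complements lengths in `W_I`; doing it twice restores
them. -/
theorem length_conj_longest (hI : cs.IsFinitary I) {a : W} (ha : a ∈ cs.parabolic I) :
    cs.length (cs.longest I * a * cs.longest I) = cs.length a := by
  have h1 := length_mul_longest hI (mul_mem (longest_mem hI) ha)
  have h2 := length_longest_mul hI ha
  omega

theorem conj_longest_mem (hI : cs.IsFinitary I) {a : W} (ha : a ∈ cs.parabolic I) :
    cs.longest I * a * cs.longest I ∈ cs.parabolic I :=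
  mul_mem (mul_mem (longest_mem hI) ha) (longest_mem hI)

/-- Conjugation by `w_I` permutes the simple reflections in `I`. -/
theorem exists_simple_conj_longest (hI : cs.IsFinitary I) {i : B} (hi : i ∈ I) :
    ∃ j ∈ I, cs.simple j = cs.longest I * cs.simple i * cs.longest I := by
  have h1 := length_conj_longest hI (cs.simple_mem_parabolic hi)
  rw [length_simple, length_eq_one_iff] at h1
  obtain ⟨j, hj⟩ := h1
  refine ⟨j, ?_, hj.symm⟩
  rw [← cs.simple_mem_parabolic_iff, ← hj]
  exact conj_longest_mem hI (cs.simple_mem_parabolic hi)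

theorem longest_mul_simple_eq (hI : cs.IsFinitary I) {i j : B}
    (h : cs.simple j = cs.longest I * cs.simple i * cs.longest I) :
    cs.longest I * cs.simple i = cs.simple j * cs.longest I := by
  rw [h, mul_assoc _ (cs.longest I), longest_mul_self hI, mul_one]

theorem conj_longest_symm (hI : cs.IsFinitary I) {i j : B}
    (h : cs.simple j = cs.longest I * cs.simple i * cs.longest I) :
    cs.simple i = cs.longest I * cs.simple j * cs.longest I := by
  rw [mul_assoc, ← longest_mul_simple_eq hI h, longest_mul_longest_mul hI]

theorem length_longest_lt {K : Set B} (hK : cs.IsFinitary K) (h : I ⊂ K) :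
    cs.length (cs.longest I) < cs.length (cs.longest K) := by
  have hI := hK.mono h.1
  have hmem := cs.parabolic_mono h.1 (longest_mem hI)
  refine lt_of_le_of_ne ((longest_spec hK).2 _ hmem) fun he => h.ne ?_
  have h1 := length_mul_longest hK hmem
  have h2 : cs.length (cs.longest I * cs.longest K) = 0 := by omega
  rw [length_eq_zero_iff] at h2
  have h3 := eq_inv_of_mul_eq_one_left h2
  rw [longest_inv hK] at h3
  rw [← leftDescents_longest hI, h3, leftDescents_longest hK]

end Longest

/-! ### The Coxeter monoid -/

open Classical in
/-- The right-handed version of `simpleStar`. -/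
noncomputable def starSimple (w : W) (t : B) : W :=
  if cs.IsRightDescent w t then w else w * cs.simple t

/-- The exchanged letter cannot lie in `w`, so it is the final `s_j`. -/
theorem simple_mul_eq_mul_simple {w : W} {i j : B} (hi : ¬ cs.IsLeftDescent w i)
    (h : cs.IsLeftDescent (w * cs.simple j) i) :
    cs.simple i * w = w * cs.simple j := by
  rcases cs.exchange_left_mul (cs.mem_parabolic_univ w) (cs.mem_parabolic_univ (cs.simple j)) h with
    ⟨-, h1⟩ | ⟨c, -, h1, h2⟩
  · exact absurd h1 hi
  · rw [length_simple, Nat.lt_one_iff, length_eq_zero_iff] at h1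
    rw [h1, mul_one] at h2
    simpa using (congrArg (cs.simple i * ·) h2).symm

/-- Left and right multiplication by simple reflections in the Coxeter monoid commute. -/
theorem starSimple_simpleStar (i j : B) (w : W) :
    cs.starSimple (cs.simpleStar i w) j = cs.simpleStar i (cs.starSimple w j) := by
  by_cases hi : cs.IsLeftDescent w i <;> by_cases hj : cs.IsRightDescent w j
  · simp [starSimple, simpleStar, hi, hj]
  · have : cs.IsLeftDescent (w * cs.simple j) i := by
      have h1 := cs.length_mul_le (cs.simple i * w) (cs.simple j)
      have h2 := (cs.not_isRightDescent_iff).1 hj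
      rw [length_simple, mul_assoc] at h1
      unfold IsLeftDescent at hi ⊢
      omega
    simp [starSimple, simpleStar, hi, hj, this]
  · have : cs.IsRightDescent (cs.simple i * w) j := by
      have h1 := cs.length_mul_le (cs.simple i) (w * cs.simple j)
      have h2 := (cs.not_isLeftDescent_iff).1 hi
      rw [length_simple, ← mul_assoc] at h1
      unfold IsRightDescent at hj ⊢
      omega
    simp [starSimple, simpleStar, hi, hj, this]
  · have h1 := (cs.not_isLeftDescent_iff).1 hi
    have h2 := (cs.not_isRightDescent_iff).1 hj
    -- The delicate case: if `s_i` shortens `w s_j`, then `s_i w = w s_j`, and both sides equal this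
    -- element.
    by_cases h : cs.IsLeftDescent (w * cs.simple j) i
    · have he := cs.simple_mul_eq_mul_simple hi h
      have : cs.IsRightDescent (w * cs.simple j) j := by
        unfold IsRightDescent
        rw [simple_mul_simple_cancel_right]
        omega
      simp [starSimple, simpleStar, hi, hj, h, he, this]
    · have h3 := (cs.not_isLeftDescent_iff).1 h
      have : ¬ cs.IsRightDescent (cs.simple i * w) j := by
        rw [not_isRightDescent_iff, mul_assoc]
        omega
      simp [starSimple, simpleStar, hi, hj, h, this, mul_assoc]

/-- With `w = 1` this converts left action by a word of `x` into right action on `x`, so the reduced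
word chosen in `star` does not matter. -/
theorem foldr_simpleStar_foldl_starSimple (ω η : List B) (w : W) :
    ω.foldr cs.simpleStar (η.foldl cs.starSimple w) =
      η.foldl cs.starSimple (ω.foldr cs.simpleStar w) := by
  have h1 : ∀ (j : B) (w : W), ω.foldr cs.simpleStar (cs.starSimple w j) =
      cs.starSimple (ω.foldr cs.simpleStar w) j := by
    intro j w
    induction ω with
    | nil => rfl
    | cons i ω ih => rw [List.foldr_cons, List.foldr_cons, ih, starSimple_simpleStar]
  induction η generalizing w with
  | nil => rfl
  | cons j η ih => rw [List.foldl_cons, List.foldl_cons, ih, h1]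

theorem foldr_simpleStar_one {ω : List B} (hω : cs.IsReduced ω) :
    ω.foldr cs.simpleStar 1 = cs.wordProd ω := by
  induction ω with
  | nil => simp
  | cons i ω ih =>
    have hr : cs.IsReduced ω := hω.drop 1
    have hl := hω.eq
    rw [wordProd_cons, List.length_cons] at hl
    rw [List.foldr_cons, ih hr, simpleStar, if_neg, wordProd_cons]
    rw [not_isLeftDescent_iff, hl, hr.eq]

theorem foldl_starSimple {η : List B} {x : W}
    (h : cs.length (x * cs.wordProd η) = cs.length x + η.length) :
    η.foldl cs.starSimple x = x * cs.wordProd η := by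
  induction η generalizing x with
  | nil => simp
  | cons j η ih =>
    rw [wordProd_cons, ← mul_assoc, List.length_cons] at h
    have h1 := cs.length_mul_le (x * cs.simple j) (cs.wordProd η)
    have h2 := cs.length_wordProd_le η
    have h3 : ¬ cs.IsRightDescent x j := by
      unfold IsRightDescent
      omega
    have h4 := (cs.not_isRightDescent_iff).1 h3
    rw [List.foldl_cons, starSimple, if_neg h3, ih (by omega), wordProd_cons, mul_assoc]

theorem foldl_starSimple_of_isRightDescent {η : List B} {x : W}
    (h : ∀ j ∈ η, cs.IsRightDescent x j) : η.foldl cs.starSimple x = x := by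
  induction η with
  | nil => rfl
  | cons j η ih =>
    rw [List.foldl_cons, starSimple, if_pos (h j (by simp))]
    exact ih fun k hk => h k (by simp [hk])

/-- If `x` absorbs `W_J` on the right, `b ∈ W_J` and lengths add in `b v` and in `x v`, then
`x * (b v) = x v` in the Coxeter monoid. -/
theorem star_mul_of_absorb {J : Set B} {x b v : W} (hx : ∀ j ∈ J, cs.IsRightDescent x j)
    (hb : b ∈ cs.parabolic J) (hbv : cs.IsReducedMul b v) (hxv : cs.IsReducedMul x v) :
    cs.star x (b * v) = x * v := by
  obtain ⟨η, hη, hJ, rfl⟩ := cs.exists_isReduced_of_mem_parabolic hb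
  obtain ⟨ζ, hζ, rfl⟩ := cs.exists_isReduced v
  unfold IsReducedMul at hbv hxv
  have hred : cs.wordProd η * cs.wordProd ζ = (η ++ ζ).foldl cs.starSimple 1 := by
    rw [foldl_starSimple, one_mul, wordProd_append]
    rw [one_mul, length_one, wordProd_append, hbv, hη.eq, hζ.eq, List.length_append, zero_add]
  have hω := Classical.choose_spec (cs.exists_isReduced x)
  rw [star, hred, foldr_simpleStar_foldl_starSimple, cs.foldr_simpleStar_one hω.1, ← hω.2,
    List.foldl_append, cs.foldl_starSimple_of_isRightDescent fun j hj => hx j (hJ j hj),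
    foldl_starSimple]
  rw [hxv, hζ.eq]

/-! ### Minimal and maximal elements of double cosets -/

theorem mem_coset {I J : Set B} {w y : W} : y ∈ cs.coset I J w ↔
    ∃ a ∈ cs.parabolic I, ∃ b ∈ cs.parabolic J, y = a * w * b :=
  DoubleCoset.mem_doubleCoset

theorem self_mem_coset (I J : Set B) (w : W) : w ∈ cs.coset I J w :=
  cs.mem_coset.2 ⟨1, one_mem _, 1, one_mem _, by simp⟩

theorem coset_eq_of_mem {I J : Set B} {w y : W} (h : y ∈ cs.coset I J w) :
    cs.coset I J y = cs.coset I J w :=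
  DoubleCoset.doubleCoset_eq_of_mem h

theorem mul_mem_coset {I J : Set B} {w y a : W} (ha : a ∈ cs.parabolic I)
    (h : y ∈ cs.coset I J w) : a * y ∈ cs.coset I J w := by
  obtain ⟨c, hc, d, hd, rfl⟩ := cs.mem_coset.1 h
  exact cs.mem_coset.2 ⟨a * c, mul_mem ha hc, d, hd, by simp [mul_assoc]⟩

theorem mem_coset_mul {I J : Set B} {w y b : W} (hb : b ∈ cs.parabolic J)
    (h : y ∈ cs.coset I J w) : y * b ∈ cs.coset I J w := by
  obtain ⟨c, hc, d, hd, rfl⟩ := cs.mem_coset.1 h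
  exact cs.mem_coset.2 ⟨c, hc, d * b, mul_mem hd hb, by simp [mul_assoc]⟩

/-! ### Bruhat order and minimal representatives -/

section Bruhat

variable {cs}

theorem BruhatLE.eq_or_length_lt {u v : W} (h : cs.BruhatLE u v) :
    u = v ∨ cs.length u < cs.length v := by
  induction h with
  | refl => exact Or.inl rfl
  | tail _ h ih =>
    obtain ⟨t, -, -, h⟩ := h
    rcases ih with rfl | ih
    · exact Or.inr h
    · exact Or.inr (ih.trans h)

theorem BruhatLE.antisymm {u v : W} (h : cs.BruhatLE u v) (h' : cs.BruhatLE v u) : u = v := by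
  rcases h.eq_or_length_lt with h1 | h1
  · exact h1
  · rcases h'.eq_or_length_lt with h2 | h2
    · exact h2.symm
    · omega

theorem bruhatLE_simple_mul {u : W} {i : B} (h : ¬ cs.IsLeftDescent u i) :
    cs.BruhatLE u (cs.simple i * u) := by
  refine Relation.ReflTransGen.single ⟨u⁻¹ * cs.simple i * u, ⟨u⁻¹, i, by simp⟩, by group, ?_⟩
  rw [(cs.not_isLeftDescent_iff).1 h]
  omega

theorem bruhatLE_mul_simple {u : W} {i : B} (h : ¬ cs.IsRightDescent u i) :
    cs.BruhatLE u (u * cs.simple i) := by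
  refine Relation.ReflTransGen.single ⟨cs.simple i, cs.isReflection_simple i, rfl, ?_⟩
  rw [(cs.not_isRightDescent_iff).1 h]
  omega

end Bruhat

/-- `m` has neither left descents in `I` nor right descents in `J`. -/
def IsMinRep (I J : Set B) (m : W) : Prop :=
  (∀ i ∈ I, ¬ cs.IsLeftDescent m i) ∧ ∀ j ∈ J, ¬ cs.IsRightDescent m j

variable {cs} in
-- Induct on `ℓ(b)` in `m = a y b`. A left descent `j` of `b` is a right descent of `a y = m b⁻¹`;
-- as it is not one of `y`, exchange gives `a y s_j = a' y`, so `m = a' y (s_j b)` with a shorter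
-- last factor. When `b = 1`, additivity for both `y` and `m` forces `a = 1`.
theorem IsMinRep.eq_of_mem {I J : Set B} {m y : W} (hm : cs.IsMinRep I J m)
    (hy : cs.IsMinRep I J y) (h : m ∈ cs.coset I J y) : m = y := by
  obtain ⟨a, ha, b, hb, he⟩ := cs.mem_coset.1 h
  clear h
  induction hn : cs.length b using Nat.strong_induction_on generalizing a b with
  | _ n ih =>
  by_cases hb1 : b = 1
  · subst hb1
    rw [mul_one] at he
    have h1 := cs.length_mul_of_not_isLeftDescent hy.1 ha
    have h2 := cs.length_mul_of_not_isLeftDescent hm.1 (inv_mem ha)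
    rw [he, inv_mul_cancel_left, length_inv] at h2
    have h3 : cs.length a = 0 := by omega
    rw [length_eq_zero_iff] at h3
    rw [he, h3, one_mul]
  · obtain ⟨j, hj⟩ := cs.exists_leftDescent_of_ne_one hb1
    have hjJ := cs.mem_of_isLeftDescent hb hj
    have hz : a * y = m * b⁻¹ := by rw [he, mul_inv_cancel_right]
    have hd : cs.IsRightDescent (a * y) j := by
      have h1 := cs.length_mul_of_not_isRightDescent hm.2 (inv_mem hb)
      have hs := mul_mem (inv_mem hb) (cs.simple_mem_parabolic hjJ)
      have h2 := cs.length_mul_of_not_isRightDescent hm.2 hs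
      rw [← isRightDescent_inv_iff] at hj
      unfold IsRightDescent at hj ⊢
      rw [hz, mul_assoc]
      omega
    rcases cs.exchange_right_mul ha (cs.mem_parabolic_univ y) hd with ⟨-, h1⟩ | ⟨a', ha', -, h2⟩
    · exact absurd h1 (hy.2 j hjJ)
    · refine ih _ ?_ a' ha' (cs.simple j * b) (mul_mem (cs.simple_mem_parabolic hjJ) hb) ?_ rfl
      · rw [← hn]; exact hj
      · rw [← h2, he]
        simp [mul_assoc]

/-- From any `y`, strip left descents in `I` and right descents in `J`, going down in Bruhat order.
The end point has no such descents, so by uniqueness it is the shortest element. -/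
theorem exists_bruhat_min (I J : Set B) (w : W) :
    ∃ m ∈ cs.coset I J w, ∀ y ∈ cs.coset I J w, cs.BruhatLE m y := by
  set p := cs.coset I J w with hp
  have hne : p.Nonempty := ⟨w, cs.self_mem_coset I J w⟩
  set m := Function.argminOn cs.length p hne with hm
  have hmp : m ∈ p := Function.argminOn_mem _ _ _
  have hmin : ∀ y ∈ p, cs.length m ≤ cs.length y := fun y hy => Function.argminOn_le _ _ hy
  have hrep : cs.IsMinRep I J m :=
    ⟨fun i hi h => absurd h (hmin _ (cs.mul_mem_coset (cs.simple_mem_parabolic hi) hmp)).not_gt,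
      fun j hj h => absurd h (hmin _ (cs.mem_coset_mul (cs.simple_mem_parabolic hj) hmp)).not_gt⟩
  refine ⟨m, hmp, fun y hy => ?_⟩
  induction hn : cs.length y using Nat.strong_induction_on generalizing y with
  | _ n ih =>
  by_cases hL : ∃ i ∈ I, cs.IsLeftDescent y i
  · obtain ⟨i, hi, hd⟩ := hL
    have h1 := ih _ (hn ▸ hd) _ (cs.mul_mem_coset (cs.simple_mem_parabolic hi) hy) rfl
    have h2 := bruhatLE_simple_mul ((cs.isLeftDescent_iff_not_isLeftDescent_mul).1 hd)
    rw [simple_mul_simple_cancel_left] at h2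
    exact h1.trans h2
  · by_cases hR : ∃ j ∈ J, cs.IsRightDescent y j
    · obtain ⟨i, hi, hd⟩ := hR
      have h1 := ih _ (hn ▸ hd) _ (cs.mem_coset_mul (cs.simple_mem_parabolic hi) hy) rfl
      have h2 := bruhatLE_mul_simple ((cs.isRightDescent_iff_not_isRightDescent_mul).1 hd)
      rw [simple_mul_simple_cancel_right] at h2
      exact h1.trans h2
    · push Not at hL hR
      rw [hrep.eq_of_mem ⟨hL, hR⟩ (by rw [cs.coset_eq_of_mem hy]; exact hmp)]
      exact Relation.ReflTransGen.refl

theorem minElt_spec (I J : Set B) (w : W) :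
    cs.minElt (cs.coset I J w) ∈ cs.coset I J w ∧ cs.IsMinRep I J (cs.minElt (cs.coset I J w)) := by
  obtain ⟨h1, h2⟩ := Classical.epsilon_spec (p := fun x => x ∈ cs.coset I J w ∧
    ∀ y ∈ cs.coset I J w, cs.BruhatLE x y) (cs.exists_bruhat_min I J w)
  refine ⟨h1, fun i hi h => ?_, fun j hj h => ?_⟩
  · have h3 := h2 _ (cs.mul_mem_coset (cs.simple_mem_parabolic hi) h1)
    rcases h3.eq_or_length_lt with h4 | h4
    · exact cs.length_simple_mul_ne _ _ (congrArg cs.length h4.symm)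
    · exact absurd h h4.not_gt
  · have h3 := h2 _ (cs.mem_coset_mul (cs.simple_mem_parabolic hj) h1)
    rcases h3.eq_or_length_lt with h4 | h4
    · exact cs.length_mul_simple_ne _ _ (congrArg cs.length h4.symm)
    · exact absurd h h4.not_gt

variable {cs} in
theorem IsMinRep.minElt_eq {I J : Set B} {m : W} (hm : cs.IsMinRep I J m) :
    cs.minElt (cs.coset I J m) = m :=
  (cs.minElt_spec I J m).2.eq_of_mem hm (cs.minElt_spec I J m).1

/-! ### Core cosets -/

/-- `m` is the minimal element of a core `(I, J)`-coset. -/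
structure IsCoreRep (I J : Set B) (m : W) : Prop where
  finitary_left : cs.IsFinitary I
  finitary_right : cs.IsFinitary J
  not_isLeftDescent : ∀ i ∈ I, ¬ cs.IsLeftDescent m i
  exists_right : ∀ i ∈ I, ∃ j ∈ J, cs.simple i * m = m * cs.simple j
  exists_left : ∀ j ∈ J, ∃ i ∈ I, cs.simple i * m = m * cs.simple j

variable {cs} in
theorem IsCore.isCoreRep {I J : Set B} {p : Set W} (h : cs.IsCore I J p) :
    cs.IsCoreRep I J (cs.minElt p) ∧ p = cs.coset I J (cs.minElt p) := by
  obtain ⟨⟨hI, hJ, w, rfl⟩, hl, hr⟩ := h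
  have hs := cs.minElt_spec I J w
  refine ⟨⟨hI, hJ, hs.2.1, fun i hi => ?_, fun j hj => ?_⟩, (cs.coset_eq_of_mem hs.1).symm⟩
  · rw [← hl] at hi
    obtain ⟨-, j, hj, he⟩ := hi
    exact ⟨j, hj, by rw [he, inv_mul_cancel_right]⟩
  · rw [← hr] at hj
    obtain ⟨-, i, hi, he⟩ := hj
    exact ⟨i, hi, by rw [he]; group⟩

namespace IsCoreRep

variable {cs} {I J : Set B} {m : W}

theorem isMinRep (h : cs.IsCoreRep I J m) : cs.IsMinRep I J m := by
  refine ⟨h.not_isLeftDescent, fun j hj => ?_⟩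
  obtain ⟨i, hi, he⟩ := h.exists_left j hj
  have := h.not_isLeftDescent i hi
  unfold IsLeftDescent at this
  unfold IsRightDescent
  rwa [← he]

theorem isCore (h : cs.IsCoreRep I J m) : cs.IsCore I J (cs.coset I J m) := by
  refine ⟨⟨h.finitary_left, h.finitary_right, m, rfl⟩, ?_, ?_⟩
  · ext i
    rw [leftRed, h.isMinRep.minElt_eq]
    refine ⟨fun hi => hi.1, fun hi => ⟨hi, ?_⟩⟩
    obtain ⟨j, hj, he⟩ := h.exists_right i hi
    exact ⟨j, hj, by rw [← he, mul_inv_cancel_right]⟩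
  · ext j
    rw [rightRed, h.isMinRep.minElt_eq]
    refine ⟨fun hj => hj.1, fun hj => ⟨hj, ?_⟩⟩
    obtain ⟨i, hi, he⟩ := h.exists_left j hj
    exact ⟨i, hi, by rw [mul_assoc, he, inv_mul_cancel_left]⟩

theorem length_mul (h : cs.IsCoreRep I J m) {a : W} (ha : a ∈ cs.parabolic I) :
    cs.length (a * m) = cs.length a + cs.length m :=
  cs.length_mul_of_not_isLeftDescent h.not_isLeftDescent ha

theorem length_mul' (h : cs.IsCoreRep I J m) {b : W} (hb : b ∈ cs.parabolic J) :
    cs.length (m * b) = cs.length m + cs.length b :=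
  cs.length_mul_of_not_isRightDescent h.isMinRep.2 hb

theorem exists_mul_eq (h : cs.IsCoreRep I J m) {b : W} (hb : b ∈ cs.parabolic J) :
    ∃ a ∈ cs.parabolic I, a * m = m * b := by
  refine cs.parabolic_induction (P := fun b => ∃ a ∈ cs.parabolic I, a * m = m * b)
    ⟨1, one_mem _, by simp⟩ ?_ hb
  rintro j hj b - - ⟨a, ha, he⟩
  obtain ⟨i, hi, he'⟩ := h.exists_left j hj
  exact ⟨cs.simple i * a, mul_mem (cs.simple_mem_parabolic hi) ha, by
    rw [mul_assoc, he, ← mul_assoc, he', mul_assoc]⟩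

/-- Conjugation by `m` carries `W_J` into `W_I` compatibly with length and simple reflections, so
the image of `w_J` has every element of `I` as a left descent. -/
theorem longest_mul (h : cs.IsCoreRep I J m) : cs.longest I * m = m * cs.longest J := by
  obtain ⟨a, ha, he⟩ := h.exists_mul_eq (longest_mem h.finitary_right)
  suffices a = cs.longest I by rw [← this, he]
  refine eq_longest h.finitary_left ha fun i hi => ?_
  obtain ⟨j, hj, he'⟩ := h.exists_right i hi
  have h1 := h.length_mul (mul_mem (cs.simple_mem_parabolic hi) ha)
  have h2 := h.length_mul ha
  rw [mul_assoc, he, ← mul_assoc, he', mul_assoc, h.length_mul'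
    (mul_mem (cs.simple_mem_parabolic hj) (longest_mem h.finitary_right))] at h1
  rw [he, h.length_mul' (longest_mem h.finitary_right)] at h2
  have h3 : cs.IsLeftDescent (cs.longest J) j :=
    (leftDescents_longest h.finitary_right).ge hj
  change cs.length (cs.simple i * a) < cs.length a
  unfold IsLeftDescent at h3
  omega

theorem exists_eq_mul (h : cs.IsCoreRep I J m) {y : W} (hy : y ∈ cs.coset I J m) :
    ∃ a ∈ cs.parabolic I, y = a * m := by
  obtain ⟨a, ha, b, hb, rfl⟩ := cs.mem_coset.1 hy
  obtain ⟨c, hc, he⟩ := h.exists_mul_eq hb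
  exact ⟨a * c, mul_mem ha hc, by rw [mul_assoc, ← he, mul_assoc]⟩

theorem bruhatLE_longest_mul (h : cs.IsCoreRep I J m) {a : W} (ha : a ∈ cs.parabolic I) :
    cs.BruhatLE (a * m) (cs.longest I * m) := by
  induction hn : cs.length (cs.longest I) - cs.length a using Nat.strong_induction_on
    generalizing a with
  | _ n ih =>
  by_cases hd : I ⊆ cs.leftDescents a
  · rw [eq_longest h.finitary_left ha hd]
    exact Relation.ReflTransGen.refl
  · obtain ⟨i, hi, hid⟩ := Set.not_subset.1 hd
    have hid' : ¬ cs.IsLeftDescent a i := hid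
    have hmem := mul_mem (cs.simple_mem_parabolic hi) ha
    have h1 := (cs.not_isLeftDescent_iff).1 hid'
    have h2 := (longest_spec h.finitary_left).2 _ hmem
    have h3 := ih _ (by omega) hmem rfl
    rw [mul_assoc] at h3
    refine (bruhatLE_simple_mul ?_).trans h3
    rw [not_isLeftDescent_iff, ← mul_assoc, h.length_mul hmem, h.length_mul ha]
    omega

/-- The double coset is already `W_I m`, and any `a m` climbs to `w_I m` by left multiplications in
`I`. -/
theorem maxElt_eq (h : cs.IsCoreRep I J m) : cs.maxElt (cs.coset I J m) = cs.longest I * m := by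
  have hmem : cs.longest I * m ∈ cs.coset I J m :=
    cs.mul_mem_coset (longest_mem h.finitary_left) (cs.self_mem_coset I J m)
  have hmax : ∀ y ∈ cs.coset I J m, cs.BruhatLE y (cs.longest I * m) := by
    intro y hy
    obtain ⟨a, ha, rfl⟩ := h.exists_eq_mul hy
    exact h.bruhatLE_longest_mul ha
  obtain ⟨h1, h2⟩ := Classical.epsilon_spec (p := fun x => x ∈ cs.coset I J m ∧
    ∀ y ∈ cs.coset I J m, cs.BruhatLE y x) ⟨_, hmem, hmax⟩
  exact (hmax _ h1).antisymm (h2 _ hmem)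

theorem subset_leftDescents_longest_mul (h : cs.IsCoreRep I J m) :
    I ⊆ cs.leftDescents (cs.longest I * m) := by
  intro i hi
  have h1 : cs.IsLeftDescent (cs.longest I) i := (leftDescents_longest h.finitary_left).ge hi
  have h2 := h.length_mul (mul_mem (cs.simple_mem_parabolic hi) (longest_mem h.finitary_left))
  have h3 := h.length_mul (longest_mem h.finitary_left)
  change cs.length (cs.simple i * (cs.longest I * m)) < cs.length (cs.longest I * m)
  unfold IsLeftDescent at h1
  rw [← mul_assoc]
  omega

/-- The maximal element of a core coset has no left descents outside `I` exactly for identity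
cosets. -/
theorem leftDescents_eq_iff (h : cs.IsCoreRep I J m) :
    cs.leftDescents (cs.longest I * m) = I ↔ I = J ∧ m = 1 := by
  constructor
  · intro hD
    have hm : m = 1 := by
      by_contra hm
      obtain ⟨i, hi⟩ := cs.exists_leftDescent_of_ne_one hm
      suffices i ∈ cs.leftDescents (cs.longest I * m) from
        h.not_isLeftDescent i (hD ▸ this) hi
      -- In the form `m w_J`, where lengths add, a left descent of `m` is visibly one of the
      -- product.
      rw [h.longest_mul]
      have h1 := h.length_mul' (longest_mem h.finitary_right)
      have h2 := cs.length_mul_le (cs.simple i * m) (cs.longest J)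
      change cs.length (cs.simple i * (m * cs.longest J)) < cs.length (m * cs.longest J)
      unfold IsLeftDescent at hi
      rw [← mul_assoc]
      omega
    refine ⟨?_, hm⟩
    subst hm
    ext k
    constructor
    · intro hk
      obtain ⟨j, hj, he⟩ := h.exists_right k hk
      rw [mul_one, one_mul] at he
      rwa [cs.simple_injective he]
    · intro hk
      obtain ⟨i, hi, he⟩ := h.exists_left k hk
      rw [mul_one, one_mul] at he
      rwa [← cs.simple_injective he]
  · rintro ⟨-, rfl⟩
    rw [mul_one, leftDescents_longest h.finitary_left]

end IsCoreRep

theorem isCoreRep_one {I : Set B} (hI : cs.IsFinitary I) : cs.IsCoreRep I I 1 :=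
  ⟨hI, hI, fun i _ => cs.not_isLeftDescent_one i, fun i hi => ⟨i, hi, by simp⟩,
    fun i hi => ⟨i, hi, by simp⟩⟩

/-! ### Atomic cosets -/

section Atomic

variable {cs} {I : Set B} {s t : B}

theorem mem_of_simple_eq_conj_longest (hK : cs.IsFinitary (insert s I))
    (ht : cs.simple t = cs.longest (insert s I) * cs.simple s * cs.longest (insert s I)) :
    t ∈ insert s I := by
  obtain ⟨j, hj, he⟩ := exists_simple_conj_longest hK (Set.mem_insert s I)
  rwa [cs.simple_injective (ht.trans he.symm)]

theorem insert_sdiff_ssubset (hK : cs.IsFinitary (insert s I))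
    (ht : cs.simple t = cs.longest (insert s I) * cs.simple s * cs.longest (insert s I)) :
    insert s I \ {t} ⊂ insert s I :=
  ⟨Set.sdiff_subset, fun h => (h (mem_of_simple_eq_conj_longest hK ht)).2 rfl⟩

/-- Conjugation by `w_{Is}` permutes `Is` and takes `s` to `t`, so it takes the complement `I` of
`s` to the complement of `t`. -/
theorem exists_mem_sdiff_conj_longest (hs : s ∉ I) (hK : cs.IsFinitary (insert s I))
    (ht : cs.simple t = cs.longest (insert s I) * cs.simple s * cs.longest (insert s I))
    {i : B} (hi : i ∈ I) : ∃ j ∈ insert s I \ {t},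
    cs.simple j = cs.longest (insert s I) * cs.simple i * cs.longest (insert s I) := by
  obtain ⟨j, hj, he⟩ := exists_simple_conj_longest hK (Set.mem_insert_of_mem s hi)
  refine ⟨j, ⟨hj, ?_⟩, he⟩
  rintro rfl
  have h := conj_longest_symm hK ht
  rw [← conj_longest_symm hK he] at h
  exact hs (cs.simple_injective h ▸ hi)

theorem exists_mem_conj_longest (hK : cs.IsFinitary (insert s I))
    (ht : cs.simple t = cs.longest (insert s I) * cs.simple s * cs.longest (insert s I))
    {j : B} (hj : j ∈ insert s I \ {t}) : ∃ i ∈ I,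
    cs.simple i = cs.longest (insert s I) * cs.simple j * cs.longest (insert s I) := by
  obtain ⟨i, hi, he⟩ := exists_simple_conj_longest hK hj.1
  refine ⟨i, hi.resolve_left ?_, he⟩
  rintro rfl
  have h := conj_longest_symm hK he
  rw [← ht] at h
  exact hj.2 (cs.simple_injective h)

/-- Conjugation by `w_I` permutes `I`, and conjugation by `w_{Is}` then matches `I` with `Is \ t`.
Minimality holds since `w_{Is}` reverses lengths: `s_i w_I` is shorter than `w_I`. -/
theorem isCoreRep_atomic (hs : s ∉ I) (hK : cs.IsFinitary (insert s I))
    (ht : cs.simple t = cs.longest (insert s I) * cs.simple s * cs.longest (insert s I)) :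
    cs.IsCoreRep I (insert s I \ {t}) (cs.longest I * cs.longest (insert s I)) := by
  have hsub := Set.subset_insert s I
  have hI := hK.mono hsub
  have conj {i i' j : B} (hii : cs.simple i' = cs.longest I * cs.simple i * cs.longest I)
      (hij : cs.simple j = cs.longest (insert s I) * cs.simple i' * cs.longest (insert s I)) :
      cs.simple i * (cs.longest I * cs.longest (insert s I)) =
        cs.longest I * cs.longest (insert s I) * cs.simple j := by
    rw [← mul_assoc, ← longest_mul_simple_eq hI (conj_longest_symm hI hii), mul_assoc, mul_assoc,
      longest_mul_simple_eq hK (conj_longest_symm hK hij)]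
  refine ⟨hI, hK.mono Set.sdiff_subset, fun i hi => ?_, fun i hi => ?_, fun j hj => ?_⟩
  · have hmem := longest_mem hI
    have hmem' := mul_mem (cs.simple_mem_parabolic hi) hmem
    have h1 := length_mul_longest hK (cs.parabolic_mono hsub hmem)
    have h2 := length_mul_longest hK (cs.parabolic_mono hsub hmem')
    have h3 : cs.IsLeftDescent (cs.longest I) i := (leftDescents_longest hI).ge hi
    unfold IsLeftDescent at h3 ⊢
    rw [← mul_assoc]
    omega
  · obtain ⟨i', hi', hii⟩ := exists_simple_conj_longest hI hi
    obtain ⟨j, hj, hij⟩ := exists_mem_sdiff_conj_longest hs hK ht hi'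
    exact ⟨j, hj, conj hii hij⟩
  · obtain ⟨i', hi', hij⟩ := exists_mem_conj_longest hK ht hj
    obtain ⟨i, hi, hii⟩ := exists_simple_conj_longest hI hi'
    exact ⟨i, hi, conj (conj_longest_symm hI hii) (conj_longest_symm hK hij)⟩

theorem coset_longest_insert (hK : cs.IsFinitary (insert s I))
    (I' : Set B) : cs.coset I I' (cs.longest (insert s I)) =
    cs.coset I I' (cs.longest I * cs.longest (insert s I)) :=
  (cs.coset_eq_of_mem (cs.mul_mem_coset (longest_mem (hK.mono (Set.subset_insert s I)))
    (cs.self_mem_coset _ _ _))).symm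

theorem maxElt_atomic (hs : s ∉ I) (hK : cs.IsFinitary (insert s I))
    (ht : cs.simple t = cs.longest (insert s I) * cs.simple s * cs.longest (insert s I)) :
    cs.maxElt (cs.coset I (insert s I \ {t}) (cs.longest (insert s I))) =
    cs.longest (insert s I) := by
  rw [coset_longest_insert hK, (isCoreRep_atomic hs hK ht).maxElt_eq,
    longest_mul_longest_mul (hK.mono (Set.subset_insert s I))]

theorem plusMinus_eq_cons (I : Set B) (l : List (B × B)) : ∃ L, plusMinus I l = I :: L := by
  cases l with
  | nil => exact ⟨_, rfl⟩
  | cons x l => exact ⟨_, rfl⟩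

theorem singleStep_insert (hs : s ∉ I) :
    SingleStep I (insert s I) := ⟨s, Or.inl ⟨hs, rfl⟩⟩

theorem singleStep_sdiff {K : Set B} (h : t ∈ K) : SingleStep K (K \ {t}) :=
  ⟨t, Or.inr ⟨by simp, by rw [Set.insert_sdiff_singleton, Set.insert_eq_of_mem h]⟩⟩

theorem exprElt_cons_cons (hK : cs.IsFinitary (insert s I))
    (ht : cs.simple t = cs.longest (insert s I) * cs.simple s * cs.longest (insert s I))
    (L : List (Set B)) :
    cs.exprElt (I :: insert s I :: (insert s I \ {t}) :: L) =
      cs.longest (insert s I) * (cs.longest (insert s I \ {t}))⁻¹ *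
        cs.exprElt ((insert s I \ {t}) :: L) := by
  rw [exprElt, if_pos (Set.subset_insert s I), exprElt,
    if_neg (insert_sdiff_ssubset hK ht).not_subset, one_mul]

theorem exprLength_cons_cons (hK : cs.IsFinitary (insert s I))
    (ht : cs.simple t = cs.longest (insert s I) * cs.simple s * cs.longest (insert s I))
    (L : List (Set B)) :
    cs.exprLength (I :: insert s I :: (insert s I \ {t}) :: L) =
      cs.length (cs.longest (insert s I)) - cs.length (cs.longest (insert s I \ {t})) +
        cs.exprLength ((insert s I \ {t}) :: L) := by
  rw [exprLength, if_pos (Set.subset_insert s I), exprLength,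
    if_neg (insert_sdiff_ssubset hK ht).not_subset, zero_add]

theorem isExpression_cons_cons (hs : s ∉ I) (hK : cs.IsFinitary (insert s I))
    (ht : cs.simple t = cs.longest (insert s I) * cs.simple s * cs.longest (insert s I))
    {J : Set B} {L : List (Set B)}
    (h : cs.IsExpression (insert s I \ {t}) J ((insert s I \ {t}) :: L)) :
    cs.IsExpression I J (I :: insert s I :: (insert s I \ {t}) :: L) := by
  obtain ⟨-, h2, h3, h4⟩ := h
  refine ⟨rfl, by simpa using h2, ?_, ?_⟩
  · intro X hX
    rcases List.mem_cons.1 hX with rfl | hX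
    · exact hK.mono (Set.subset_insert s X)
    · rcases List.mem_cons.1 hX with rfl | hX
      · exact hK
      · exact h3 X hX
  · exact List.isChain_cons_cons.2 ⟨singleStep_insert hs, List.isChain_cons_cons.2
      ⟨singleStep_sdiff (mem_of_simple_eq_conj_longest hK ht), h4⟩⟩

theorem isExpression_singleton {J : Set B} (hJ : cs.IsFinitary J) : cs.IsExpression J J [J] :=
  ⟨rfl, rfl, by simpa using hJ, List.isChain_singleton _⟩

theorem isReducedExpr_atomic (hs : s ∉ I) (hK : cs.IsFinitary (insert s I))
    (ht : cs.simple t = cs.longest (insert s I) * cs.simple s * cs.longest (insert s I)) :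
    cs.IsReducedExpr I (insert s I \ {t})
    [I, insert s I, insert s I \ {t}]
    (cs.coset I (insert s I \ {t}) (cs.longest (insert s I))) := by
  have hI' : cs.IsFinitary (insert s I \ {t}) := hK.mono Set.sdiff_subset
  refine ⟨⟨hK.mono (Set.subset_insert s I), hI', _, rfl⟩,
    isExpression_cons_cons hs hK ht (isExpression_singleton hI'), ?_, ?_⟩
  · rw [maxElt_atomic hs hK ht, exprElt_cons_cons hK ht, exprElt, inv_mul_cancel_right]
  · rw [maxElt_atomic hs hK ht, exprLength_cons_cons hK ht, exprLength]
    ring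

theorem isAtomic_atomic (hs : s ∉ I) (hK : cs.IsFinitary (insert s I))
    (ht : cs.simple t = cs.longest (insert s I) * cs.simple s * cs.longest (insert s I)) :
    cs.IsAtomic I (insert s I \ {t})
    (cs.coset I (insert s I \ {t}) (cs.longest (insert s I))) := by
  refine ⟨?_, s, t, isReducedExpr_atomic hs hK ht⟩
  rw [coset_longest_insert hK]
  exact (isCoreRep_atomic hs hK ht).isCore

end Atomic

/-! ### Splitting off an atomic coset -/

namespace IsCoreRep

variable {cs} {I J : Set B} {m : W} {s t : B}

theorem simple_mul_longest_mul (h : cs.IsCoreRep I J m)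
    {i i' j : B}
    (hii : cs.simple i' = cs.longest I * cs.simple i * cs.longest I)
    (hij : cs.simple i' * m = m * cs.simple j) :
    cs.simple i * (cs.longest I * m) = cs.longest I * m * cs.simple j := by
  have hI := h.finitary_left
  rw [← mul_assoc, ← longest_mul_simple_eq hI (conj_longest_symm hI hii), mul_assoc, mul_assoc, hij]

theorem isFinitary_insert (h : cs.IsCoreRep I J m)
    (hs : s ∈ cs.leftDescents (cs.longest I * m)) :
    cs.IsFinitary (insert s I) :=
  cs.isFinitary_of_subset_leftDescents
    (Set.insert_subset hs h.subset_leftDescents_longest_mul)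

theorem length_mul_longest_insert (h : cs.IsCoreRep I J m)
    (hs : s ∈ cs.leftDescents (cs.longest I * m) \ I)
    {a : W} (ha : a ∈ cs.parabolic (insert s I)) :
    cs.length a + cs.length (a * (cs.longest I * m)) = cs.length (cs.longest I * m) := by
  have := cs.length_add_length_inv_mul
    (Set.insert_subset hs.1 h.subset_leftDescents_longest_mul) (inv_mem ha)
  rwa [inv_inv, length_inv] at this

/-- `w_{Is} r̄` is minimal in its left `W_{Is}`-coset. -/
theorem not_isLeftDescent_longest_insert_mul (h : cs.IsCoreRep I J m)
    (hs : s ∈ cs.leftDescents (cs.longest I * m) \ I)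
    {k : B} (hk : k ∈ insert s I) :
    ¬ cs.IsLeftDescent (cs.longest (insert s I) * (cs.longest I * m)) k := by
  have hK := h.isFinitary_insert hs.1
  have h1 := h.length_mul_longest_insert hs (longest_mem hK)
  have h2 := h.length_mul_longest_insert hs
    (mul_mem (cs.simple_mem_parabolic hk) (longest_mem hK))
  have h3 : cs.IsLeftDescent (cs.longest (insert s I)) k := (leftDescents_longest hK).ge hk
  unfold IsLeftDescent at h3 ⊢
  rw [← mul_assoc]
  omega

/-- The matching of `Is \ t` with `J` is a composite of three: by `w_{Is}` onto `I`, by `w_I` within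
`I`, and by `m` onto `J`. -/
theorem isCoreRep_rest (h : cs.IsCoreRep I J m) (hs : s ∈ cs.leftDescents (cs.longest I * m) \ I)
    (ht : cs.simple t = cs.longest (insert s I) * cs.simple s * cs.longest (insert s I)) :
    cs.IsCoreRep (insert s I \ {t}) J
    (cs.longest (insert s I) * (cs.longest I * m)) := by
  have hK := h.isFinitary_insert hs.1
  have hI := h.finitary_left
  have conj {i i' j k : B} (hji : cs.simple i = cs.longest (insert s I) * cs.simple k *
        cs.longest (insert s I))
      (hii : cs.simple i' = cs.longest I * cs.simple i * cs.longest I)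
      (hij : cs.simple i' * m = m * cs.simple j) :
      cs.simple k * (cs.longest (insert s I) * (cs.longest I * m)) =
        cs.longest (insert s I) * (cs.longest I * m) * cs.simple j := by
    rw [← mul_assoc, ← longest_mul_simple_eq hK (conj_longest_symm hK hji), mul_assoc, mul_assoc,
      h.simple_mul_longest_mul hii hij]
  refine ⟨hK.mono Set.sdiff_subset, h.finitary_right,
    fun k hk => h.not_isLeftDescent_longest_insert_mul hs hk.1, fun k hk => ?_, fun j hj => ?_⟩
  · obtain ⟨i, hi, hji⟩ := exists_mem_conj_longest hK ht hk
    obtain ⟨i', hi', hii⟩ := exists_simple_conj_longest hI hi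
    obtain ⟨j, hj, hij⟩ := h.exists_right i' hi'
    exact ⟨j, hj, conj hji hii hij⟩
  · obtain ⟨i', hi', hij⟩ := h.exists_left j hj
    obtain ⟨i, hi, hii⟩ := exists_simple_conj_longest hI hi'
    obtain ⟨k, hk, hki⟩ := exists_mem_sdiff_conj_longest hs.2 hK ht hi
    exact ⟨k, hk, conj (conj_longest_symm hK hki) (conj_longest_symm hI hii) hij⟩

theorem coset_rest (h : cs.IsCoreRep I J m) (hs : s ∈ cs.leftDescents (cs.longest I * m) \ I) :
    cs.coset (insert s I \ {t}) J
    (cs.longest (insert s I \ {t}) * cs.longest (insert s I) * (cs.longest I * m)) =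
      cs.coset (insert s I \ {t}) J (cs.longest (insert s I) * (cs.longest I * m)) := by
  have hK := h.isFinitary_insert hs.1
  rw [mul_assoc]
  exact cs.coset_eq_of_mem (cs.mul_mem_coset (longest_mem (hK.mono Set.sdiff_subset))
    (cs.self_mem_coset _ _ _))

theorem maxElt_rest (h : cs.IsCoreRep I J m) (hs : s ∈ cs.leftDescents (cs.longest I * m) \ I)
    (ht : cs.simple t = cs.longest (insert s I) * cs.simple s * cs.longest (insert s I)) :
    cs.maxElt (cs.coset (insert s I \ {t}) J
    (cs.longest (insert s I \ {t}) * cs.longest (insert s I) * (cs.longest I * m))) =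
      cs.longest (insert s I \ {t}) * (cs.longest (insert s I) * (cs.longest I * m)) := by
  rw [h.coset_rest hs, (h.isCoreRep_rest hs ht).maxElt_eq]

theorem length_maxElt_rest (h : cs.IsCoreRep I J m)
    (hs : s ∈ cs.leftDescents (cs.longest I * m) \ I)
    (ht : cs.simple t = cs.longest (insert s I) * cs.simple s * cs.longest (insert s I)) :
    cs.length (cs.longest I * m) =
    cs.length (cs.longest (insert s I)) +
      cs.length (cs.longest (insert s I) * (cs.longest I * m)) ∧
    cs.length (cs.longest (insert s I \ {t}) * (cs.longest (insert s I) * (cs.longest I * m))) =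
      cs.length (cs.longest (insert s I \ {t})) +
        cs.length (cs.longest (insert s I) * (cs.longest I * m)) := by
  have hK := h.isFinitary_insert hs.1
  exact ⟨(h.length_mul_longest_insert hs (longest_mem hK)).symm,
    (h.isCoreRep_rest hs ht).length_mul (longest_mem (hK.mono Set.sdiff_subset))⟩

/-- Every element of `Is` is a right descent of `w_{Is}`, so the factor from `W_{Is \ t}` is
absorbed. -/
theorem star_rest (h : cs.IsCoreRep I J m) (hs : s ∈ cs.leftDescents (cs.longest I * m) \ I)
    (ht : cs.simple t = cs.longest (insert s I) * cs.simple s * cs.longest (insert s I)) :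
    cs.star (cs.longest (insert s I))
    (cs.longest (insert s I \ {t}) * (cs.longest (insert s I) * (cs.longest I * m))) =
      cs.longest I * m := by
  have hK := h.isFinitary_insert hs.1
  have hl := h.length_maxElt_rest hs ht
  rw [cs.star_mul_of_absorb (J := insert s I \ {t}), longest_mul_longest_mul hK]
  · intro j hj
    rw [← isLeftDescent_inv_iff, longest_inv hK]
    exact (leftDescents_longest hK).ge hj.1
  · exact longest_mem (hK.mono Set.sdiff_subset)
  · exact hl.2
  · unfold IsReducedMul
    rw [longest_mul_longest_mul hK]
    exact hl.1

theorem isReducedComp_rest (h : cs.IsCoreRep I J m)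
    (hs : s ∈ cs.leftDescents (cs.longest I * m) \ I)
    (ht : cs.simple t = cs.longest (insert s I) * cs.simple s * cs.longest (insert s I)) :
    cs.IsReducedComp (insert s I \ {t})
    (cs.coset I (insert s I \ {t}) (cs.longest (insert s I)))
    (cs.coset (insert s I \ {t}) J
      (cs.longest (insert s I \ {t}) * cs.longest (insert s I) * (cs.longest I * m))) := by
  have hK := h.isFinitary_insert hs.1
  have hI' : cs.IsFinitary (insert s I \ {t}) := hK.mono Set.sdiff_subset
  have hl := h.length_maxElt_rest hs ht
  have h1 := length_longest_mul hK (cs.parabolic_mono Set.sdiff_subset (longest_mem hI'))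
  rw [IsReducedComp, maxElt_atomic hs.2 hK ht, h.maxElt_rest hs ht, h.star_rest hs ht,
    IsReducedMul, IsReducedMul, longest_inv hI', longest_mul_longest_mul hI',
    mul_assoc (cs.longest (insert s I)), longest_mul_longest_mul hI', longest_mul_longest_mul hK]
  exact ⟨by omega, rfl, hl.1, rfl⟩

theorem comp_rest (h : cs.IsCoreRep I J m) (hs : s ∈ cs.leftDescents (cs.longest I * m) \ I)
    (ht : cs.simple t = cs.longest (insert s I) * cs.simple s * cs.longest (insert s I)) :
    cs.comp I J (cs.coset I (insert s I \ {t}) (cs.longest (insert s I)))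
    (cs.coset (insert s I \ {t}) J
      (cs.longest (insert s I \ {t}) * cs.longest (insert s I) * (cs.longest I * m))) =
    cs.coset I J m := by
  rw [comp, maxElt_atomic hs.2 (h.isFinitary_insert hs.1) ht, h.maxElt_rest hs ht,
    h.star_rest hs ht]
  exact cs.coset_eq_of_mem (cs.mul_mem_coset (longest_mem h.finitary_left)
    (cs.self_mem_coset _ _ _))

end IsCoreRep

/-- One step of the algorithm splits off an atomic coset and leaves a shorter core coset. -/
theorem AlgStep.spec {cs : CoxeterSystem M W} {I J I' : Set B} {r q : Set W} {s t : B}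
    (hr : cs.IsCore I J r) (h : cs.AlgStep J I r s t I' q) :
    cs.IsFinitary (insert s I) ∧
      cs.IsAtomic I I' (cs.coset I I' (cs.longest (insert s I))) ∧
      cs.IsReducedExpr I I' [I, insert s I, I'] (cs.coset I I' (cs.longest (insert s I))) ∧
      cs.IsCore I' J q ∧
      cs.IsReducedComp I' (cs.coset I I' (cs.longest (insert s I))) q ∧
      r = cs.comp I J (cs.coset I I' (cs.longest (insert s I))) q ∧
      cs.length (cs.maxElt q) < cs.length (cs.maxElt r) ∧
      cs.maxElt r = cs.longest (insert s I) * (cs.longest I')⁻¹ * cs.maxElt q ∧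
      (cs.length (cs.maxElt r) : ℤ) = cs.length (cs.longest (insert s I)) -
        cs.length (cs.longest I') + cs.length (cs.maxElt q) := by
  obtain ⟨hs, ht, rfl, rfl⟩ := h
  obtain ⟨hm, hrm⟩ := hr.isCoreRep
  set m := cs.minElt r
  have hmax : cs.maxElt r = cs.longest I * m := by rw [hrm, hm.maxElt_eq]
  rw [hmax] at hs ⊢
  have hK := hm.isFinitary_insert hs.1
  have hI' : cs.IsFinitary (insert s I \ {t}) := hK.mono Set.sdiff_subset
  have hl := hm.length_maxElt_rest hs ht
  have hlt := length_longest_lt hK (insert_sdiff_ssubset hK ht)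
  refine ⟨hK, isAtomic_atomic hs.2 hK ht, isReducedExpr_atomic hs.2 hK ht, ?_,
    hm.isReducedComp_rest hs ht, ?_, ?_, ?_, ?_⟩
  · rw [hm.coset_rest hs]
    exact (hm.isCoreRep_rest hs ht).isCore
  · rw [hm.comp_rest hs ht, ← hrm]
  · rw [hm.maxElt_rest hs ht]
    omega
  · rw [hm.maxElt_rest hs ht, mul_assoc, inv_mul_cancel_left, longest_mul_longest_mul hK]
  · rw [hm.maxElt_rest hs ht]
    omega

/-! ### Reduced expressions of identity and atomic cosets -/

section Expression

variable {cs} {X Z : Set B} {L : List (Set B)}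

theorem IsExpression.cases_cons (h : cs.IsExpression X Z L) :
    (L = [X] ∧ X = Z) ∨ ∃ Y L', L = X :: Y :: L' ∧ SingleStep X Y ∧ cs.IsFinitary X ∧
      cs.IsFinitary Y ∧ cs.IsExpression Y Z (Y :: L') := by
  obtain ⟨h1, h2, h3, h4⟩ := h
  match L, h1, h2, h3, h4 with
  | [A], h1, h2, _, _ =>
    simp only [List.head?_cons, Option.some.injEq, List.getLast?_singleton] at h1 h2
    subst h1
    exact Or.inl ⟨rfl, h2⟩
  | A :: Y :: L', h1, h2, h3, h4 =>
    simp only [List.head?_cons, Option.some.injEq] at h1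
    subst h1
    rw [List.isChain_cons_cons] at h4
    refine Or.inr ⟨Y, L', rfl, h4.1, h3 _ (by simp), h3 _ (by simp), rfl, ?_,
      fun K hK => h3 K (List.mem_cons_of_mem _ hK), h4.2⟩
    simpa using h2

theorem SingleStep.ssubset_or_ssubset {Y : Set B} (h : SingleStep X Y) : X ⊂ Y ∨ Y ⊂ X := by
  obtain ⟨s, ⟨hs, rfl⟩ | ⟨hs, rfl⟩⟩ := h
  · exact Or.inl (Set.ssubset_insert hs)
  · exact Or.inr (Set.ssubset_insert hs)

/-- Induction on expressions, from the right end. -/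
theorem IsExpression.induction {P : Set B → List (Set B) → Prop} (single : P Z [Z])
    (up : ∀ X Y L, cs.IsFinitary Y → X ⊂ Y → P Y (Y :: L) → P X (X :: Y :: L))
    (down : ∀ X Y L, cs.IsFinitary X → Y ⊂ X → P Y (Y :: L) → P X (X :: Y :: L))
    (h : cs.IsExpression X Z L) : P X L := by
  induction L generalizing X with
  | nil => simp [IsExpression] at h
  | cons A L ih =>
    rcases h.cases_cons with ⟨h1, rfl⟩ | ⟨Y, L', h1, hXY, hX, hY, h2⟩
    · rwa [h1]
    · rw [h1]
      obtain rfl : L = Y :: L' := (List.cons.inj h1).2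
      rcases hXY.ssubset_or_ssubset with hlt | hlt
      · exact up X Y L' hY hlt (ih h2)
      · exact down X Y L' hX hlt (ih h2)

theorem exprElt_up {Y : Set B} (h : X ⊂ Y) (L : List (Set B)) :
    cs.exprElt (X :: Y :: L) = cs.exprElt (Y :: L) := by
  rw [exprElt, if_pos h.subset, one_mul]

theorem exprElt_down {Y : Set B} (h : Y ⊂ X) (L : List (Set B)) :
    cs.exprElt (X :: Y :: L) = cs.longest X * (cs.longest Y)⁻¹ * cs.exprElt (Y :: L) := by
  rw [exprElt, if_neg h.not_subset]

theorem exprLength_up {Y : Set B} (h : X ⊂ Y) (L : List (Set B)) :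
    cs.exprLength (X :: Y :: L) = cs.exprLength (Y :: L) := by
  rw [exprLength, if_pos h.subset, zero_add]

theorem exprLength_down {Y : Set B} (h : Y ⊂ X) (L : List (Set B)) :
    cs.exprLength (X :: Y :: L) =
      cs.length (cs.longest X) - cs.length (cs.longest Y) + cs.exprLength (Y :: L) := by
  rw [exprLength, if_neg h.not_subset]

/-- A descending step accounts exactly for the change of `ℓ(w_X)`, while an ascending step
contributes zero although `ℓ(w_X)` grows. Each ascent thus makes the inequality strict. -/
theorem IsExpression.length_head_le (h : cs.IsExpression X Z L) :
    (cs.length (cs.longest X) : ℤ) ≤ cs.exprLength L := by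
  refine h.induction (P := fun X L => (cs.length (cs.longest X) : ℤ) ≤ cs.exprLength L) ?_ ?_ ?_
  · rw [exprLength]
  · intro X Y L hY hlt ih
    have := length_longest_lt hY hlt
    rw [exprLength_up hlt]
    omega
  · intro X Y L hX hlt ih
    rw [exprLength_down hlt]
    omega

/-- An expression of the smallest possible length only removes simple reflections. -/
theorem IsExpression.subset_of_exprLength_eq (h : cs.IsExpression X Z L)
    (hl : cs.exprLength L = cs.length (cs.longest X)) : Z ⊆ X := by
  induction L generalizing X with
  | nil => simp [IsExpression] at h
  | cons A L ih =>
    rcases h.cases_cons with ⟨h1, rfl⟩ | ⟨Y, L', h1, hXY, hX, hY, h2⟩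
    · exact subset_rfl
    · obtain rfl : L = Y :: L' := (List.cons.inj h1).2
      rw [h1] at hl
      rcases hXY.ssubset_or_ssubset with hlt | hlt
      · have h3 := length_longest_lt hY hlt
        have h4 := h2.length_head_le
        rw [exprLength_up hlt] at hl
        omega
      · rw [exprLength_down hlt] at hl
        exact (ih h2 (by omega)).trans hlt.subset

theorem IsExpression.eq_singleton (h : cs.IsExpression X X L)
    (hl : cs.exprLength L = cs.length (cs.longest X)) : L = [X] := by
  rcases h.cases_cons with ⟨h1, -⟩ | ⟨Y, L', h1, hXY, hX, hY, h2⟩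
  · exact h1
  · exfalso
    rw [h1] at hl
    rcases hXY.ssubset_or_ssubset with hlt | hlt
    · have h3 := length_longest_lt hY hlt
      have h4 := h2.length_head_le
      rw [exprLength_up hlt] at hl
      omega
    · rw [exprLength_down hlt] at hl
      exact hlt.not_subset (h2.subset_of_exprLength_eq (by omega))

theorem length_longest_mul_longest_inv {Y : Set B} (hX : cs.IsFinitary X) (h : Y ⊆ X) :
    cs.length (cs.longest Y) + cs.length (cs.longest X * (cs.longest Y)⁻¹) =
      cs.length (cs.longest X) := by
  have := length_longest_mul hX (inv_mem (cs.parabolic_mono h (longest_mem (hX.mono h))))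
  rwa [length_inv] at this

theorem IsExpression.length_exprElt_le (h : cs.IsExpression X Z L) :
    (cs.length (cs.exprElt L) : ℤ) ≤ cs.exprLength L := by
  refine h.induction (P := fun _ L => (cs.length (cs.exprElt L) : ℤ) ≤ cs.exprLength L) ?_ ?_ ?_
  · rw [exprLength, exprElt]
  · intro X Y L hY hlt ih
    rwa [exprLength_up hlt, exprElt_up hlt]
  · intro X Y L hX hlt ih
    rw [exprLength_down hlt, exprElt_down hlt]
    have h1 := length_longest_mul_longest_inv hX hlt.subset
    have h2 := cs.length_mul_le (cs.longest X * (cs.longest Y)⁻¹) (cs.exprElt (Y :: L))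
    omega

/-- The length hypothesis passes to tails, since every estimate involved must be an equality. At a
descent from `X` to `Y`, `w_Y` is a prefix of the tail's element `y`, so `w_X (w_Y⁻¹ y)` has
additive lengths and inherits the left descents of `w_X`. -/
theorem IsExpression.descents (h : cs.IsExpression X Z L)
    (hl : (cs.length (cs.exprElt L) : ℤ) = cs.exprLength L) :
    X ⊆ cs.leftDescents (cs.exprElt L) ∧ ∀ j ∈ Z, cs.IsRightDescent (cs.exprElt L) j := by
  induction L generalizing X with
  | nil => simp [IsExpression] at h
  | cons A L ih =>
    rcases h.cases_cons with ⟨h1, rfl⟩ | ⟨Y, L', h1, hXY, hX, hY, h2⟩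
    · have hX : cs.IsFinitary X := h.2.2.1 X (by simp [h1])
      rw [h1, exprElt]
      refine ⟨(leftDescents_longest hX).ge, fun j hj => ?_⟩
      rw [← isLeftDescent_inv_iff, longest_inv hX]
      exact (leftDescents_longest hX).ge hj
    · obtain rfl : L = Y :: L' := (List.cons.inj h1).2
      rw [h1] at hl ⊢
      rcases hXY.ssubset_or_ssubset with hlt | hlt
      · rw [exprElt_up hlt] at hl ⊢
        rw [exprLength_up hlt] at hl
        exact ⟨hlt.subset.trans (ih h2 hl).1, (ih h2 hl).2⟩
      · rw [exprElt_down hlt] at hl ⊢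
        rw [exprLength_down hlt] at hl
        set y := cs.exprElt (Y :: L')
        have h3 := length_longest_mul_longest_inv hX hlt.subset
        have h4 := cs.length_mul_le (cs.longest X * (cs.longest Y)⁻¹) y
        have h5 : (cs.length y : ℤ) ≤ cs.exprLength (Y :: L') := h2.length_exprElt_le
        obtain ⟨h6, h7⟩ := ih h2 (by omega)
        have h8 := cs.length_add_length_inv_mul h6 (longest_mem hY)
        refine ⟨fun i hi => ?_, fun j hj => ?_⟩
        · have h9 : cs.IsLeftDescent (cs.longest X) i := (leftDescents_longest hX).ge hi
          have h10 := cs.length_mul_le (cs.simple i * cs.longest X) ((cs.longest Y)⁻¹ * y)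
          change cs.length (cs.simple i * (cs.longest X * (cs.longest Y)⁻¹ * y)) <
            cs.length (cs.longest X * (cs.longest Y)⁻¹ * y)
          simp only [mul_assoc] at h10 hl h4 ⊢
          unfold IsLeftDescent at h9
          omega
        · have h9 := h7 j hj
          have h10 := cs.length_mul_le (cs.longest X * (cs.longest Y)⁻¹) (y * cs.simple j)
          rw [← mul_assoc] at h10
          unfold IsRightDescent at h9 ⊢
          omega

end Expression

variable {cs} in
theorem IsIdentity.isReducedExpr_iff {I J : Set B} {r : Set W} (h : cs.IsIdentity I J r)
    (L : List (Set B)) : cs.IsReducedExpr I J L r ↔ L = [I] := by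
  obtain ⟨hc, rfl, hm⟩ := h
  obtain ⟨hI, -, w, hw⟩ := id hc
  have hspec := cs.minElt_spec I I w
  rw [← hw, hm] at hspec
  have hr : r = cs.coset I I 1 := by
    rw [hw]
    exact (cs.coset_eq_of_mem (hw ▸ hspec.1)).symm
  have hmax : cs.maxElt r = cs.longest I := by
    rw [hr, (cs.isCoreRep_one hI).maxElt_eq, mul_one]
  constructor
  · rintro ⟨-, h1, -, h2⟩
    exact h1.eq_singleton (by rw [← h2, hmax])
  · rintro rfl
    exact ⟨hc, isExpression_singleton hI, by rw [hmax, exprElt], by rw [hmax, exprLength]⟩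

variable {cs} in
-- An initial ascent must add `s` by descents, and then length leaves only the removal of `t`; an
-- initial descent is excluded by right descents.
theorem isReducedExpr_atomic_iff {I : Set B} {s t : B} (hs : s ∉ I)
    (hK : cs.IsFinitary (insert s I))
    (ht : cs.simple t = cs.longest (insert s I) * cs.simple s * cs.longest (insert s I))
    (L : List (Set B)) :
    cs.IsReducedExpr I (insert s I \ {t}) L
      (cs.coset I (insert s I \ {t}) (cs.longest (insert s I))) ↔
    L = [I, insert s I, insert s I \ {t}] := by
  refine ⟨?_, fun h => h ▸ isReducedExpr_atomic hs hK ht⟩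
  rintro ⟨-, h1, h2, h3⟩
  rw [maxElt_atomic hs hK ht] at h2 h3
  have htK := mem_of_simple_eq_conj_longest hK ht
  have hI := hK.mono (Set.subset_insert s I)
  have hred : (cs.length (cs.exprElt L) : ℤ) = cs.exprLength L := by rw [← h2, h3]
  rcases h1.cases_cons with ⟨rfl, -⟩ | ⟨X, L', rfl, hIX, -, hX, h4⟩
  · exfalso
    have := length_longest_lt hK (Set.ssubset_insert hs)
    rw [exprLength] at h3
    omega
  · obtain ⟨x, ⟨hx, rfl⟩ | ⟨hx, rfl⟩⟩ := hIX
    · have hlt := Set.ssubset_insert hx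
      rw [exprElt_up hlt] at h2 hred
      rw [exprLength_up hlt] at h3 hred
      have hxs : x = s := by
        have h5 := (h4.descents hred).1 (Set.mem_insert x I)
        rw [← h2, leftDescents_longest hK] at h5
        exact h5.resolve_right hx
      subst hxs
      rcases h4.cases_cons with ⟨h5, h6⟩ | ⟨Y, L'', h5, hY, -, hYf, h6⟩
      · exact absurd h6 (insert_sdiff_ssubset hK ht).ne'
      · obtain rfl := (List.cons.inj h5).2
        rcases hY.ssubset_or_ssubset with hlt' | hlt'
        · exfalso
          have h7 := length_longest_lt hYf hlt'
          have h8 := h6.length_head_le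
          rw [exprLength_up hlt'] at h3
          omega
        · rw [exprLength_down hlt'] at h3
          -- The rest has minimal length sum, so it only removes reflections; thus `Is \ t ⊆ Y ⊂
          -- Is`, which determines `Y`.
          have h7 : cs.exprLength (Y :: L'') = cs.length (cs.longest Y) := by omega
          have h8 := h6.subset_of_exprLength_eq h7
          have hYI : Y = insert x I \ {t} := by
            refine Set.Subset.antisymm (fun k hk => ⟨hlt'.subset hk, ?_⟩) h8
            rintro rfl
            refine hlt'.not_subset fun j hj => ?_
            by_cases hjk : j = k
            · rwa [hjk]
            · exact h8 ⟨hj, hjk⟩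
          subst hYI
          rw [h6.eq_singleton h7]
    · exfalso
      set K := insert s (insert x X) with hKdef
      set I := insert x X with hIdef
      have hlt : X ⊂ I := Set.ssubset_insert hx
      have h5 := length_longest_mul_longest_inv hI hlt.subset
      have h6 := h4.length_exprElt_le
      rw [exprElt_down hlt] at h2 hred
      rw [exprLength_down hlt] at hred
      set y := cs.exprElt (X :: L') with hy
      have h7 := cs.length_mul_le (cs.longest I * (cs.longest X)⁻¹) y
      have h8 := (h4.descents (by rw [← hy]; omega)).2
      set u := cs.longest X * (cs.longest I)⁻¹ with hu
      have hyu : y = u * cs.longest K := by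
        rw [h2, hu]; group
      have huI : u ∈ cs.parabolic I :=
        mul_mem (cs.parabolic_mono hlt.subset (longest_mem hX)) (inv_mem (longest_mem hI))
      have hIK : I ⊆ K := Set.subset_insert s I
      -- The tail's element `y = u w_K` has all of `Is \ t` as right descents. Moving a reflection
      -- past `w_K` turns these into ascents of `u` at all of `I`, so `u ∈ W_I` is trivial and `w_X
      -- = w_I`, which is absurd for `X ⊂ I`.
      have hu1 : u = 1 := by
        by_contra hne
        obtain ⟨i, hi⟩ := cs.exists_rightDescent_of_ne_one hne
        have hiI : i ∈ I := by
          rw [← isLeftDescent_inv_iff] at hi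
          exact cs.mem_of_isLeftDescent (inv_mem huI) hi
        obtain ⟨j, hj, hji⟩ := exists_mem_sdiff_conj_longest hs hK ht hiI
        have h9 := h8 j hj
        have h10 := length_mul_longest hK (cs.parabolic_mono hIK huI)
        have h11 := length_mul_longest hK
          (cs.parabolic_mono hIK (mul_mem huI (cs.simple_mem_parabolic hiI)))
        unfold IsRightDescent at h9 hi
        rw [← hy, hyu, mul_assoc, longest_mul_simple_eq hK (conj_longest_symm hK hji),
          ← mul_assoc] at h9
        omega
      rw [hu, mul_inv_eq_one] at hu1
      have := length_longest_lt hI hlt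
      rw [hu1] at this
      exact lt_irrefl _ this

/-! ### The algorithm -/

section Algorithm

variable {cs} {I J : Set B} {r : Set W}

theorem IsCore.leftDescents_eq_iff (hr : cs.IsCore I J r) :
    cs.leftDescents (cs.maxElt r) = I ↔ cs.IsIdentity I J r := by
  obtain ⟨hm, hrm⟩ := hr.isCoreRep
  have hmax : cs.maxElt r = cs.longest I * cs.minElt r := by
    conv_lhs => rw [hrm]
    exact hm.maxElt_eq
  rw [hmax, hm.leftDescents_eq_iff, IsIdentity]
  exact ⟨fun h => ⟨hr.1, h⟩, fun h => h.2⟩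

theorem IsCore.subset_leftDescents (hr : cs.IsCore I J r) :
    I ⊆ cs.leftDescents (cs.maxElt r) := by
  obtain ⟨hm, hrm⟩ := hr.isCoreRep
  rw [hrm, hm.maxElt_eq]
  exact hm.subset_leftDescents_longest_mul

theorem IsCore.sdiff_nonempty (hr : cs.IsCore I J r)
    (h : cs.leftDescents (cs.maxElt r) ≠ I) : (cs.leftDescents (cs.maxElt r) \ I).Nonempty :=
  Set.nonempty_of_ssubset (hr.subset_leftDescents.ssubset_of_ne h.symm)

theorem IsCore.exists_algStep (hr : cs.IsCore I J r) {s : B}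
    (hs : s ∈ cs.leftDescents (cs.maxElt r) \ I) : ∃ t I' q, cs.AlgStep J I r s t I' q := by
  have hK : cs.IsFinitary (insert s I) := cs.isFinitary_of_subset_leftDescents
    (Set.insert_subset hs.1 hr.subset_leftDescents)
  obtain ⟨t, -, ht⟩ := exists_simple_conj_longest hK (Set.mem_insert s I)
  exact ⟨t, _, _, hs, ht, rfl, rfl⟩

theorem IsCore.exists_algRun (hr : cs.IsCore I J r) : ∃ l, cs.AlgRun J I r l := by
  induction hn : cs.length (cs.maxElt r) using Nat.strong_induction_on generalizing I r with
  | _ n ih =>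
  by_cases hD : cs.leftDescents (cs.maxElt r) = I
  · exact ⟨[], .halt hD⟩
  · obtain ⟨s, hs⟩ := hr.sdiff_nonempty hD
    obtain ⟨t, I', q, hstep⟩ := hr.exists_algStep hs
    obtain ⟨-, -, -, hq, -, -, hlt, -, -⟩ := hstep.spec hr
    obtain ⟨l, hl⟩ := ih _ (hn ▸ hlt) hq rfl
    exact ⟨(s, t) :: l, .step hstep hl⟩

/-- Each step prepends `w_{Is} w_{I'}⁻¹` to the maximal element and adds `ℓ(w_{Is}) - ℓ(w_{I'})` to
its length, exactly the recursion for `exprElt` and `exprLength`. -/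
theorem AlgRun.isReducedAtomicExpr {l : List (B × B)} (h : cs.AlgRun J I r l)
    (hr : cs.IsCore I J r) : cs.IsReducedAtomicExpr I J l r := by
  induction h with
  | @halt I p h =>
    have hid := hr.leftDescents_eq_iff.1 h
    refine ⟨(hid.isReducedExpr_iff _).2 rfl, ?_⟩
    obtain ⟨-, rfl, hm⟩ := hid
    rw [hr.isCoreRep.2, hm]
    exact .nil
  | @step I I' p q s t l h hq ih =>
    obtain ⟨hK, h1, h2, h3, h4, h5, -, h6, h7⟩ := h.spec hr
    obtain ⟨hs, ht, rfl, -⟩ := h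
    obtain ⟨⟨-, h8, h9, h10⟩, h11⟩ := ih h3
    refine ⟨⟨hr.1, ?_⟩, ?_⟩
    · obtain ⟨L, hL⟩ := plusMinus_eq_cons (insert s I \ {t}) l
      rw [hL] at h8 h9 h10
      rw [plusMinus, hL, exprElt_cons_cons hK ht, exprLength_cons_cons hK ht, ← h9, ← h10]
      exact ⟨isExpression_cons_cons hs.2 hK ht h8, h6, h7⟩
    · rw [h5]
      exact .cons ht h1 h2 h4 h11

end Algorithm

end CoxeterSystem

/-! ### The main theorem -/

theorem mainTheorem1 {B W : Type*} [Group W] {M : CoxeterMatrix B} (cs : CoxeterSystem M W)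
    (I J : Set B) (r : Set W) (hr : cs.IsCore I J r) :
    -- a reduced atomic expression exists
    (∃ l : List (B × B), cs.IsReducedAtomicExpr I J l r) ∧
    -- an identity coset, or a reduced composition of an atomic coset and a core coset
    ((cs.IsIdentity I J r ∧ ∀ L, cs.IsReducedExpr I J L r ↔ L = [I]) ∨
      (∃ (s t : B) (I' : Set B) (p q : Set W),
        s ∉ I ∧ cs.IsFinitary (insert s I) ∧
        cs.simple t = cs.longest (insert s I) * cs.simple s * cs.longest (insert s I) ∧
        I' = insert s I \ {t} ∧
        cs.IsAtomic I I' p ∧ cs.IsCore I' J q ∧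
        cs.IsReducedComp I' p q ∧ r = cs.comp I J p q ∧
        ∀ L, cs.IsReducedExpr I I' L p ↔ L = [I, insert s I, I'])) ∧
    -- the algorithm: it halts exactly at identity cosets, and otherwise every choice of `s` works
    (cs.leftDescents (cs.maxElt r) = I ↔ cs.IsIdentity I J r) ∧
    (cs.leftDescents (cs.maxElt r) ≠ I → (cs.leftDescents (cs.maxElt r) \ I).Nonempty) ∧
    (∀ s ∈ cs.leftDescents (cs.maxElt r) \ I, ∃ t I' q, cs.AlgStep J I r s t I' q) ∧
    (∀ s t I' q, cs.AlgStep J I r s t I' q →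
      cs.IsFinitary (insert s I) ∧
      cs.IsAtomic I I' (cs.coset I I' (cs.longest (insert s I))) ∧
      cs.IsReducedExpr I I' [I, insert s I, I'] (cs.coset I I' (cs.longest (insert s I))) ∧
      cs.IsCore I' J q ∧
      cs.IsReducedComp I' (cs.coset I I' (cs.longest (insert s I))) q ∧
      r = cs.comp I J (cs.coset I I' (cs.longest (insert s I))) q ∧
      cs.length (cs.maxElt q) < cs.length (cs.maxElt r)) ∧
    (∃ l, cs.AlgRun J I r l) ∧
    (∀ l, cs.AlgRun J I r l → cs.IsReducedAtomicExpr I J l r) := by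
  obtain ⟨l, hl⟩ := hr.exists_algRun
  refine ⟨⟨l, hl.isReducedAtomicExpr hr⟩, ?_, hr.leftDescents_eq_iff, hr.sdiff_nonempty,
    fun s hs => hr.exists_algStep hs, ?_, ⟨l, hl⟩, fun l hl => hl.isReducedAtomicExpr hr⟩
  · by_cases hD : cs.leftDescents (cs.maxElt r) = I
    · have hid := hr.leftDescents_eq_iff.1 hD
      exact Or.inl ⟨hid, hid.isReducedExpr_iff⟩
    · right
      obtain ⟨s, hs⟩ := hr.sdiff_nonempty hD
      obtain ⟨t, I', q, hstep⟩ := hr.exists_algStep hs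
      obtain ⟨hK, h1, -, h3, h4, h5, -⟩ := hstep.spec hr
      obtain ⟨-, ht, rfl, -⟩ := hstep
      exact ⟨s, t, _, _, q, hs.2, hK, ht, rfl, h1, h3, h4, h5,
        CoxeterSystem.isReducedExpr_atomic_iff hs.2 hK ht⟩
  · intro s t I' q hstep
    obtain ⟨h1, h2, h3, h4, h5, h6, h7, -⟩ := hstep.spec hr
    exact ⟨h1, h2, h3, h4, h5, h6, h7⟩
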